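/- Let $L\ge 2$, let $P_1,\dots,P_L$ be probability distributions on an arbitrary measurable space, let $\Pi=(\pi_{ij})$ be an $L\times L$ matrix with nonnegative entries and rows summing to $1$, let $\tilde P_i=\sum_j\pi_{ij}P_j$, and let $S=(\mathbf 1\{\pi_{ij}>0\})$. Assume (A$'$) $P_1,\dots,P_L$ are jointly irreducible: if $\sum_i\gamma_iP_i$ ($\gamma_i\in\mathbb R$) is a probability distribution, then all $\gamma_i\ge 0$; (B$'$) $\Pi$ has full rank; and (C) no two columns of $S$ are identical. For distributions let $\kappa^*(F_0\,|\,F_1)=\max\{\kappa\in[0,1]:F_0=(1-\kappa)G+\kappa F_1\text{ for some distribution }G\}$. A residue of $F_0$ with respect to a finite family $(F_j)$ is $(F_0-\sum_j\nu_jF_j)/(1-\sum_j\nu_j)$, where $\nu$ maximizes $\sum_j\nu_j$ subject to $\nu_j\ge0$, $\sum_j\nu_j\le1$ and $F_0=(1-\sum_j\nu_j)G+\sum_j\nu_jF_j$ for some distribution $G$; it is defined when this maximum is less than $1$, and need not be unique. The algorithm PartialLabel$(S,(\tilde P_1,\dots,\tilde P_L))$ draws $Q_1,\dots,Q_L$ independently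 and uniformly from the convex hull of $\tilde P_1,\dots,\tilde P_L$. Then, for $k=2,3,\dots$, it does the following: for $i=1,\dots,L$ in this order, it sets $\bar Q_i=\frac1{L-1}\big(\sum_{j>i}Q_j+\sum_{j<i}W_j\big)$ and lets $W_i$ be any residue of $\frac1kQ_i+(1-\frac1k)\bar Q_i$ with respect to $\{Q_j\}_{j>i}\cup\{W_j\}_{j<i}$; then it runs VertexTest$(S,\tilde P,W)$, and as soon as this returns $(1,C)$ it stops and returns $C(W_1,\dots,W_L)^T$. VertexTest$(S,\tilde P,W)$ is the following procedure. If $\kappa^*(W_i\,|\,W_j)>0$ for some $i\ne j$, return $(0,I)$. Otherwise start with the all-ones $L\times L$ matrix $C$ and, for all $i$ and $j$ with $\kappa^*(\tilde P_j\,|\,W_i)>0$, replace row $i$ of $C$ by its entrywise minimum with row $j$ of $S$. Then repeat $L$ times: for $i=1,\dots,L$, if row $i$ of $C$ is a standard basis vector $e_j^T$, replace column $j$ of $C$ by $e_i$. Return $(1,C^T)$ if $C$ is a permutation matrix, and $(0,C^T)$ otherwise. Then, whatever $Q_1,\dots,Q_L$ are drawn from the convex hull and whichever residues are chosen, if the algorithm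 returns $(R_1,\dots,R_L)$, then $R_i=P_i$ for all $i$. Moreover, with probability $1$ over the draws, for every choice of residues, all residues that the algorithm asks for exist and it terminates after finitely many steps, returning $(P_1,\dots,P_L)$. -/

import Mathlib

open MeasureTheory ProbabilityTheory

noncomputable section

namespace PartialLabel

/-! ### Distributions, joint irreducibility, the model -/

section Distributions

variable {X : Type*} [MeasurableSpace X]

/-- A probability distribution, viewed in the real vector space of finite signed measures, where
arbitrary linear combinations of distributions live. -/
def distr (P : ProbabilityMeasure X) : SignedMeasure X :=
  (P : Measure X).toSignedMeasure

/-- `σ` is a probability distribution. -/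
def IsDistribution (σ : SignedMeasure X) : Prop :=
  ∃ P : ProbabilityMeasure X, σ = distr P

/-- Joint irreducibility: a distribution that is a linear combination of `P 1, …, P L` has
nonnegative coefficients. -/
def JointlyIrreducible {L : ℕ} (P : Fin L → ProbabilityMeasure X) : Prop :=
  ∀ γ : Fin L → ℝ, IsDistribution (∑ i, γ i • distr (P i)) → ∀ i, 0 ≤ γ i

/-- The product of a real matrix with a column vector of signed measures. -/
def mix {L : ℕ} (A : Matrix (Fin L) (Fin L) ℝ) (F : Fin L → SignedMeasure X) :
    Fin L → SignedMeasure X :=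
  fun i => ∑ j, A i j • F j

/-- The contaminated distributions `M P`. -/
def contaminated {L : ℕ} (M : Matrix (Fin L) (Fin L) ℝ) (P : Fin L → ProbabilityMeasure X) :
    Fin L → SignedMeasure X :=
  mix M (fun j => distr (P j))

open Classical in
/-- The partial label matrix: the 0-1 matrix of the positive entries of the mixing matrix. -/
def partialLabelMatrix {L : ℕ} (M : Matrix (Fin L) (Fin L) ℝ) : Matrix (Fin L) (Fin L) ℝ :=
  fun i j => if 0 < M i j then 1 else 0

/-! ### The two-sample and multi-sample operators -/

/-- The two-sample operator `κ*(F₀ | F₁)`: the largest `κ ∈ [0, 1]` such that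
`F₀ = (1 - κ) G + κ F₁` for some distribution `G`. -/
def kappa (F₀ F₁ : SignedMeasure X) : ℝ :=
  sSup {κ : ℝ | κ ∈ Set.Icc (0 : ℝ) 1 ∧
    ∃ G : SignedMeasure X, IsDistribution G ∧ F₀ = (1 - κ) • G + κ • F₁}

/-- The feasible weights in the definition of the multi-sample operator
`κ*(F₀ | {F j : j})`. -/
def feasible {ι : Type*} [Fintype ι] (F₀ : SignedMeasure X) (F : ι → SignedMeasure X) :
    Set (ι → ℝ) :=
  {ν | (∀ j, 0 ≤ ν j) ∧ ∑ j, ν j ≤ 1 ∧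
    ∃ G : SignedMeasure X, IsDistribution G ∧ F₀ = (1 - ∑ j, ν j) • G + ∑ j, ν j • F j}

/-- `G` is a possible output of `Residue(F₀ | {F j : j})`: for some `ν` achieving the maximum in
`κ*(F₀ | {F j : j})`, one has `G = (F₀ - ∑ j, ν j F j) / (1 - ∑ j, ν j)`, the denominator
being nonzero. -/
def IsResidue {ι : Type*} [Fintype ι] (F₀ : SignedMeasure X) (F : ι → SignedMeasure X)
    (G : SignedMeasure X) : Prop :=
  ∃ ν ∈ feasible F₀ F, (∀ ν' ∈ feasible F₀ F, ∑ j, ν' j ≤ ∑ j, ν j) ∧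
    1 - ∑ j, ν j ≠ 0 ∧ G = (1 - ∑ j, ν j)⁻¹ • (F₀ - ∑ j, ν j • F j)

/-! ### VertexTest -/

open Classical in
/-- Row `i` of the matrix `C` after the first pair of loops that modify it: start from
`(1, …, 1)` and, for `j = 1, …, L`, take the entrywise minimum with row `j` of `S` whenever
`κ*(Pt j | Q i) ∈ (0, 1]`. -/
def initialC {L : ℕ} (S : Matrix (Fin L) (Fin L) ℝ) (Pt Q : Fin L → SignedMeasure X) :
    Matrix (Fin L) (Fin L) ℝ :=
  fun i => (List.finRange L).foldl
    (fun r j => if kappa (Pt j) (Q i) ∈ Set.Ioc (0 : ℝ) 1 then r ⊓ S j else r) (fun _ => 1)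

open Classical in
/-- If row `i` of `C` is the standard basis vector `e_j`, replace column `j` of `C` by `e_i`. -/
def resolveRow {L : ℕ} (C : Matrix (Fin L) (Fin L) ℝ) (i : Fin L) : Matrix (Fin L) (Fin L) ℝ :=
  if h : ∃ j, C i = Pi.single j 1 then C.updateCol h.choose (Pi.single i 1) else C

/-- One pass of `resolveRow` over `i = 1, …, L`. -/
def resolvePass {L : ℕ} (C : Matrix (Fin L) (Fin L) ℝ) : Matrix (Fin L) (Fin L) ℝ :=
  (List.finRange L).foldl resolveRow C

open Classical in
/-- `VertexTest(S, Pt, Q)`. -/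
def vertexTest {L : ℕ} (S : Matrix (Fin L) (Fin L) ℝ) (Pt Q : Fin L → SignedMeasure X) :
    Bool × Matrix (Fin L) (Fin L) ℝ :=
  if ∃ i j, i ≠ j ∧ kappa (Q i) (Q j) ∈ Set.Ioc (0 : ℝ) 1 then (false, 1)
  else
    let C := resolvePass^[L] (initialC S Pt Q)
    if ∃ σ : Equiv.Perm (Fin L), C = σ.permMatrix ℝ then (true, C.transpose)
    else (false, C.transpose)

/-! ### PartialLabel -/

/-- The entries other than the `i`-th that are used when `W i` is updated: `W j` for `j < i` and
`Q j` for `j > i`. -/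
def others {L : ℕ} (Q W : Fin L → SignedMeasure X) (i : Fin L) :
    {j : Fin L // j ≠ i} → SignedMeasure X :=
  fun j => if j.1 < i then W j.1 else Q j.1

/-- `(1/k) Q i + (1 - 1/k) Qbar i`, where `Qbar i` is the average of the entries `others`. -/
def target {L : ℕ} (k : ℕ) (Q W : Fin L → SignedMeasure X) (i : Fin L) : SignedMeasure X :=
  (1 / (k : ℝ)) • Q i + (1 - 1 / (k : ℝ)) • ((1 / ((L : ℝ) - 1)) • ∑ j, others Q W i j)

/-- A configuration of the algorithm: either it is inside the while loop with counter `k`, the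
first `i` iterations of the for loop being done and `W` being the current list of candidates, or
it has returned a vector of distributions. -/
inductive Config (X : Type*) [MeasurableSpace X] (L : ℕ)
  | running (k i : ℕ) (W : Fin L → SignedMeasure X) : Config X L
  | returned (R : Fin L → SignedMeasure X) : Config X L

/-- One step of the algorithm on the inputs `S`, `Pt`, after `Q` has been drawn. A residue need not
be unique, and any of them may be chosen. -/
inductive Step {L : ℕ} (S : Matrix (Fin L) (Fin L) ℝ) (Pt Q : Fin L → SignedMeasure X) :
    Config X L → Config X L → Prop
  | update (k : ℕ) (i : Fin L) (W : Fin L → SignedMeasure X) (G : SignedMeasure X)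
      (hG : IsResidue (target k Q W i) (others Q W i) G) :
      Step S Pt Q (Config.running k i W) (Config.running k (i + 1) (Function.update W i G))
  | again (k : ℕ) (W : Fin L → SignedMeasure X) (C : Matrix (Fin L) (Fin L) ℝ)
      (h : vertexTest S Pt W = (false, C)) :
      Step S Pt Q (Config.running k L W) (Config.running (k + 1) 0 W)
  | done (k : ℕ) (W : Fin L → SignedMeasure X) (C : Matrix (Fin L) (Fin L) ℝ)
      (h : vertexTest S Pt W = (true, C)) :
      Step S Pt Q (Config.running k L W) (Config.returned (mix C W))

/-- The configuration in which the while loop is entered: `k = 2` and `W = Q`. -/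
def start {L : ℕ} (Q : Fin L → SignedMeasure X) : Config X L :=
  Config.running 2 0 Q

/-- Configuration `c` can be reached once `Q` has been drawn. -/
def Reaches {L : ℕ} (S : Matrix (Fin L) (Fin L) ℝ) (Pt Q : Fin L → SignedMeasure X)
    (c : Config X L) : Prop :=
  Relation.ReflTransGen (Step S Pt Q) (start Q) c

/-- Once `Q` has been drawn, every execution of the algorithm is finite, and it only ever stops by
returning (in particular every residue that it asks for is well defined). -/
def Terminates {L : ℕ} (S : Matrix (Fin L) (Fin L) ℝ) (Pt Q : Fin L → SignedMeasure X) : Prop :=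
  (¬ ∃ f : ℕ → Config X L, f 0 = start Q ∧ ∀ n, Step S Pt Q (f n) (f (n + 1))) ∧
  (∀ k i W, Reaches S Pt Q (Config.running k i W) → ∃ c, Step S Pt Q (Config.running k i W) c)

end Distributions

/-! ### The random draws -/

/-- The uniform distribution on the simplex `{w : w j ≥ 0, ∑ j, w j = 1}` of `ℝ ^ L`: normalized
`(L - 1)`-dimensional Hausdorff measure. (On a hyperplane it is a constant multiple of Lebesgue
measure, for any norm.) -/
def uniformSimplex (L : ℕ) : Measure (Fin L → ℝ) :=
  ProbabilityTheory.cond (Measure.hausdorffMeasure ((L : ℝ) - 1)) (stdSimplex ℝ (Fin L))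

/-- The simplex has positive and finite Hausdorff measure, so it can be normalized. -/
theorem hausdorff_simplex (n : ℕ) :
    Measure.hausdorffMeasure (n : ℝ) (stdSimplex ℝ (Fin (n + 1))) ≠ 0 ∧
    Measure.hausdorffMeasure (n : ℝ) (stdSimplex ℝ (Fin (n + 1))) ≠ ⊤ := by
  have hvol : (Measure.hausdorffMeasure (n : ℝ) : Measure (Fin n → ℝ)) = volume := by
    simpa using hausdorffMeasure_pi_real (ι := Fin n)
  constructor
  · have hf : LipschitzWith 1 (fun (w : Fin (n + 1) → ℝ) (i : Fin n) => w i.succ) := by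
      refine LipschitzWith.of_dist_le_mul fun x y => ?_
      simp only [NNReal.coe_one, one_mul]
      exact (dist_pi_le_iff dist_nonneg).2 fun i => dist_le_pi_dist x y i.succ
    have h := hf.hausdorffMeasure_image_le (d := (n : ℝ)) (Nat.cast_nonneg n)
      (stdSimplex ℝ (Fin (n + 1)))
    have hsub : Set.pi Set.univ (fun _ : Fin n => Set.Ioo (0 : ℝ) (1 / (n + 1))) ⊆
        (fun (w : Fin (n + 1) → ℝ) (i : Fin n) => w i.succ) '' stdSimplex ℝ (Fin (n + 1)) := by
      intro x hx
      have hx' : ∀ i, 0 < x i ∧ x i < 1 / (n + 1) := fun i => hx i (Set.mem_univ i)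
      refine ⟨Fin.cons (1 - ∑ i, x i) x, ⟨?_, ?_⟩, ?_⟩
      · intro i
        refine Fin.cases ?_ (fun j => ?_) i
        · have : ∑ i, x i ≤ ∑ _i : Fin n, (1 / ((n : ℝ) + 1)) :=
            Finset.sum_le_sum fun i _ => (hx' i).2.le
          have h2 : (n : ℝ) * (1 / ((n : ℝ) + 1)) ≤ 1 := by
            rw [mul_one_div, div_le_one (by positivity)]; linarith
          simp at this h2 ⊢
          linarith
        · simpa using (hx' j).1.le
      · simp [Fin.sum_univ_succ]
      · ext i; simp
    intro h0
    rw [h0, hvol] at h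
    have h3 := (measure_mono hsub).trans h
    rw [volume_pi_pi] at h3
    simp at h3
    linarith [h3.1, (Nat.cast_nonneg n : (0 : ℝ) ≤ n)]
  · have he : LipschitzWith (n + 1)
        (fun x : Fin n → ℝ => (Fin.cons (1 - ∑ i, x i) x : Fin (n + 1) → ℝ)) := by
      refine LipschitzWith.of_dist_le_mul fun x y => ?_
      refine (dist_pi_le_iff (by positivity)).2 fun i => ?_
      refine Fin.cases ?_ (fun j => ?_) i
      · simp only [Fin.cons_zero, Real.dist_eq]
        have : |(1 - ∑ i, x i) - (1 - ∑ i, y i)| = |∑ i, (y i - x i)| := by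
          rw [Finset.sum_sub_distrib]; congr 1; ring
        rw [this]
        refine (Finset.abs_sum_le_sum_abs _ _).trans ?_
        have h1 : ∀ i ∈ Finset.univ, |y i - x i| ≤ dist x y := fun i _ => by
          rw [abs_sub_comm]; exact dist_le_pi_dist x y i
        refine (Finset.sum_le_sum h1).trans ?_
        simp
        nlinarith [dist_nonneg (x := x) (y := y)]
      · simp only [Fin.cons_succ]
        refine (dist_le_pi_dist x y j).trans ?_
        push_cast
        nlinarith [dist_nonneg (x := x) (y := y), (Nat.cast_nonneg n : (0 : ℝ) ≤ n)]
    have hsub : stdSimplex ℝ (Fin (n + 1)) ⊆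
        (fun x : Fin n → ℝ => (Fin.cons (1 - ∑ i, x i) x : Fin (n + 1) → ℝ)) ''
          Set.Icc 0 1 := by
      rintro w ⟨hw, hs⟩
      rw [Fin.sum_univ_succ] at hs
      refine ⟨fun i => w i.succ, ⟨fun i => hw _, fun i => ?_⟩, ?_⟩
      · have := Finset.single_le_sum (f := fun i : Fin n => w i.succ) (fun i _ => hw _)
          (Finset.mem_univ i)
        have h0 := hw 0
        simp at this ⊢
        linarith
      · ext i
        refine Fin.cases ?_ (fun j => ?_) i
        · simp; linarith
        · simp
    have h := (measure_mono hsub).trans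
      (he.hausdorffMeasure_image_le (d := (n : ℝ)) (Nat.cast_nonneg n) (Set.Icc 0 1))
    refine ne_top_of_le_ne_top ?_ h
    rw [hvol]
    refine ENNReal.mul_ne_top (ENNReal.rpow_ne_top_of_nonneg (Nat.cast_nonneg n) (by simp)) ?_
    exact (isCompact_Icc.measure_lt_top).ne

theorem isProbabilityMeasure_uniformSimplex (L : ℕ) (hL : 1 ≤ L) : IsProbabilityMeasure (uniformSimplex L) := by
  obtain ⟨n, rfl⟩ := Nat.exists_eq_add_of_le' hL
  have h := hausdorff_simplex n
  unfold uniformSimplex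
  rw [show ((n + 1 : ℕ) : ℝ) - 1 = n by push_cast; ring]
  exact cond_isProbabilityMeasure_of_finite h.1 h.2

/-- The law of `L` independent uniformly distributed weight vectors, the rows of a matrix `w`.
When `Pt 1, …, Pt L` are linearly independent, the entries of `mix w Pt` are then independent
uniformly distributed elements of the convex hull of `Pt 1, …, Pt L`. -/
def drawLaw (L : ℕ) : Measure (Fin L → Fin L → ℝ) :=
  Measure.pi (fun _ => uniformSimplex L)

end PartialLabel

end

open PartialLabel

namespace PartialLabel

/-! ### Coordinates with respect to a jointly irreducible family -/

section Coordinates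

variable {X : Type*} [MeasurableSpace X] {L : ℕ} {P : Fin L → ProbabilityMeasure X}

/-! Joint irreducibility makes `combo P` injective and lets a combination of the `P j` be a
distribution exactly when its coordinates lie in the standard simplex. The problem thus becomes
linear algebra in the simplex: mixture decompositions turn into coordinatewise inequalities
(`exists_distribution_iff`), and `κ* > 0` turns into inclusion of supports (`kappa_mem_Ioc_iff`).

Soundness holds for all draws. Every candidate stays in the simplex, and `VertexTest` only discards
labels that cannot belong to the support of a candidate. If the surviving labels form a permutation
matrix, each candidate is a vertex with known label (`mix_of_vertexTest_eq_true`).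

For termination, let the rows in use form a basis and let `l` be the functional dual to row `i`. It
kills all the other rows and equals `1 / k` on the target, so maximizing the removed mass amounts to
maximizing `l` on the residue. For large `k` the best vertex is reachable, so the residue is the
maximizer of `l` over the simplex (`eventually_residue_eq_single`). Vertices found earlier in the
round have `l = 0`, while the maximum is positive, so the new vertex is new. Ties are excluded by
finitely many determinant conditions (`Generic`), which hold almost surely (`ae_generic`). Hence in
some round `K` all candidates are distinct vertices. On those `VertexTest` succeeds: the columns of
`S` are distinct, so inclusion orders them partially, and the labels are resolved from the largest
columns downwards (`vertexTest_single`). -/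

/-- The signed measure with coordinates `x` with respect to `P 1, …, P L`. -/
noncomputable def combo (P : Fin L → ProbabilityMeasure X) : (Fin L → ℝ) →ₗ[ℝ] SignedMeasure X :=
  Fintype.linearCombination ℝ (fun j => distr (P j))

theorem combo_apply (P : Fin L → ProbabilityMeasure X) (x : Fin L → ℝ) :
    combo P x = ∑ j, x j • distr (P j) :=
  Fintype.linearCombination_apply ..

theorem combo_single (P : Fin L → ProbabilityMeasure X) (i : Fin L) :
    combo P (Pi.single i 1) = distr (P i) := by
  simp [combo]

theorem distr_univ (P : ProbabilityMeasure X) : distr P Set.univ = 1 := by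
  simp [distr]

theorem combo_apply_measurable (P : Fin L → ProbabilityMeasure X) (x : Fin L → ℝ) {s : Set X}
    (hs : MeasurableSet s) : combo P x s = ∑ j, x j * (P j : Measure X).real s := by
  rw [combo_apply]
  have : (∑ j, x j • distr (P j)) s = ∑ j, (x j • distr (P j)) s := by
    rw [← FunLike.coeAddMonoidHom_apply, map_sum, Finset.sum_apply]; rfl
  rw [this]
  refine Finset.sum_congr rfl fun j _ => ?_
  rw [smul_apply, distr, Measure.toSignedMeasure_apply_measurable hs, smul_eq_mul]

theorem combo_univ (P : Fin L → ProbabilityMeasure X) (x : Fin L → ℝ) :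
    combo P x Set.univ = ∑ j, x j := by
  simp [combo_apply_measurable]

theorem isDistribution_combo (P : Fin L → ProbabilityMeasure X) {x : Fin L → ℝ}
    (hx : x ∈ stdSimplex ℝ (Fin L)) : IsDistribution (combo P x) := by
  have key : ∀ s, (∑ j, ENNReal.ofReal (x j) • (P j : Measure X)) s =
      ENNReal.ofReal (∑ j, x j * (P j : Measure X).real s) := by
    intro s
    rw [ENNReal.ofReal_sum_of_nonneg fun j _ => mul_nonneg (hx.1 j) measureReal_nonneg]
    simp only [Measure.coe_finsetSum, Finset.sum_apply, Measure.smul_apply, smul_eq_mul]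
    refine Finset.sum_congr rfl fun j _ => ?_
    rw [ENNReal.ofReal_mul (hx.1 j), ofReal_measureReal]
  have hprob : IsProbabilityMeasure (∑ j, ENNReal.ofReal (x j) • (P j : Measure X)) :=
    ⟨by rw [key]; simp [hx.2]⟩
  refine ⟨⟨_, hprob⟩, VectorMeasure.ext fun s hs => ?_⟩
  rw [combo_apply_measurable P x hs]
  refine Eq.trans ?_ (Measure.toSignedMeasure_apply_measurable
    (μ := ∑ j, ENNReal.ofReal (x j) • (P j : Measure X)) hs).symm
  simp only [measureReal_def]
  rw [key, ENNReal.toReal_ofReal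
    (Finset.sum_nonneg fun j _ => mul_nonneg (hx.1 j) measureReal_nonneg)]
  rfl

theorem IsDistribution.univ {σ : SignedMeasure X} (h : IsDistribution σ) : σ Set.univ = 1 := by
  obtain ⟨Q, rfl⟩ := h
  exact distr_univ Q

theorem isDistribution_combo_iff (hA : JointlyIrreducible P) {x : Fin L → ℝ} :
    IsDistribution (combo P x) ↔ x ∈ stdSimplex ℝ (Fin L) := by
  refine ⟨fun h => ⟨hA x (by rwa [← combo_apply]), ?_⟩, isDistribution_combo P⟩
  rw [← combo_univ P, h.univ]

theorem combo_injective (hA : JointlyIrreducible P) : Function.Injective (combo P) := by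
  rw [← LinearMap.ker_eq_bot, LinearMap.ker_eq_bot']
  intro z hz
  funext j
  by_contra hj
  -- A kernel vector may be added freely to the coordinates of `P j`; the factor `2 / z j` drives
  -- the `j`-th one to `1 - 2 = -1`.
  have h : combo P (Pi.single j 1 + (-(2 / z j)) • z) = distr (P j) := by
    rw [map_add, map_smul, hz, smul_zero, add_zero, combo_single]
  have h2 := ((isDistribution_combo_iff hA).1 ⟨P j, h⟩).1 j
  simp only [Pi.add_apply, Pi.single_eq_same, Pi.smul_apply, smul_eq_mul] at h2
  rw [neg_mul, div_mul_cancel₀ _ hj] at h2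
  linarith

/-- A mixture decomposition exists iff the subtracted part is coordinatewise smaller. -/
theorem exists_distribution_iff (hA : JointlyIrreducible P) {f h : Fin L → ℝ}
    (hf : f ∈ stdSimplex ℝ (Fin L)) (hh : ∑ l, h l ≤ 1) :
    (∃ G, IsDistribution G ∧ combo P f = (1 - ∑ l, h l) • G + combo P h) ↔ h ≤ f := by
  constructor
  · rintro ⟨G, hG, e⟩
    rcases hh.eq_or_lt with h1 | h1
    · rw [h1, sub_self, zero_smul, zero_add] at e
      exact (combo_injective hA e).ge
    · have hpos : 0 < 1 - ∑ l, h l := sub_pos.2 h1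
      have e2 : combo P ((1 - ∑ l, h l)⁻¹ • (f - h)) = G := by
        rw [map_smul, map_sub, e, add_sub_cancel_right, smul_smul, inv_mul_cancel₀ hpos.ne',
          one_smul]
      rw [← e2] at hG
      intro l
      have := ((isDistribution_combo_iff hA).1 hG).1 l
      simp only [Pi.smul_apply, Pi.sub_apply, smul_eq_mul] at this
      have := (mul_nonneg_iff_of_pos_left (inv_pos.2 hpos)).1 this
      linarith
  · intro hle
    rcases hh.eq_or_lt with h1 | h1
    -- Here `G` has weight zero: equal total masses force `f = h`, and any distribution serves as
    -- `G`.
    · have hfh : f = h := by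
        have h0 : ∑ l, (f l - h l) = 0 := by rw [Finset.sum_sub_distrib, hf.2, h1, sub_self]
        rw [Finset.sum_eq_zero_iff_of_nonneg fun l _ => sub_nonneg.2 (hle l)] at h0
        exact funext fun l => sub_eq_zero.1 (h0 l (Finset.mem_univ l))
      exact ⟨combo P f, isDistribution_combo P hf, by rw [h1, hfh]; simp⟩
    · have hpos : 0 < 1 - ∑ l, h l := sub_pos.2 h1
      refine ⟨combo P ((1 - ∑ l, h l)⁻¹ • (f - h)), isDistribution_combo P ⟨fun l => ?_, ?_⟩, ?_⟩
      · exact mul_nonneg (inv_pos.2 hpos).le (sub_nonneg.2 (hle l))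
      · simp only [Pi.smul_apply, Pi.sub_apply, smul_eq_mul]
        rw [← Finset.mul_sum, Finset.sum_sub_distrib, hf.2, inv_mul_cancel₀ hpos.ne']
      · rw [map_smul, smul_smul, mul_inv_cancel₀ hpos.ne', one_smul, ← map_add, sub_add_cancel]

theorem sum_smul_combo (P : Fin L → ProbabilityMeasure X) {ι : Type*} [Fintype ι] (ν : ι → ℝ)
    (f : ι → Fin L → ℝ) : ∑ j, ν j • combo P (f j) = combo P (∑ j, ν j • f j) := by
  simp

theorem sum_sum_smul {ι : Type*} [Fintype ι] (ν : ι → ℝ) {f : ι → Fin L → ℝ}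
    (hf : ∀ j, f j ∈ stdSimplex ℝ (Fin L)) : ∑ l, (∑ j, ν j • f j) l = ∑ j, ν j := by
  simp only [Finset.sum_apply, Pi.smul_apply, smul_eq_mul]
  rw [Finset.sum_comm]
  exact Finset.sum_congr rfl fun j _ => by rw [← Finset.mul_sum, (hf j).2, mul_one]

/-- The bound `∑ ν ≤ 1` drops out: it follows from the inequality by summing coordinates. -/
theorem mem_feasible_iff (hA : JointlyIrreducible P) {ι : Type*} [Fintype ι] {f₀ : Fin L → ℝ}
    {f : ι → Fin L → ℝ} (hf₀ : f₀ ∈ stdSimplex ℝ (Fin L))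
    (hf : ∀ j, f j ∈ stdSimplex ℝ (Fin L)) {ν : ι → ℝ} :
    ν ∈ feasible (combo P f₀) (fun j => combo P (f j)) ↔
      (∀ j, 0 ≤ ν j) ∧ ∑ j, ν j • f j ≤ f₀ := by
  have hs := sum_sum_smul ν hf
  constructor
  · rintro ⟨h0, h1, hG⟩
    refine ⟨h0, (exists_distribution_iff hA hf₀ (hs ▸ h1)).1 ?_⟩
    rwa [hs, ← sum_smul_combo]
  · rintro ⟨h0, hle⟩
    have h1 : ∑ j, ν j ≤ 1 := by
      rw [← hs, ← hf₀.2]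
      exact Finset.sum_le_sum fun l _ => hle l
    refine ⟨h0, h1, ?_⟩
    have := (exists_distribution_iff hA hf₀ (hs ▸ h1)).2 hle
    rwa [hs, ← sum_smul_combo] at this

/-- The feasible weights form a nonempty compact set, so a maximizer exists. Total weight one would
make `f₀` a combination of the `f j`, which `hne` forbids. -/
theorem exists_isResidue (hA : JointlyIrreducible P) {ι : Type*} [Fintype ι] {f₀ : Fin L → ℝ}
    {f : ι → Fin L → ℝ} (hf₀ : f₀ ∈ stdSimplex ℝ (Fin L))
    (hf : ∀ j, f j ∈ stdSimplex ℝ (Fin L)) (hne : ∀ ν : ι → ℝ, f₀ ≠ ∑ j, ν j • f j) :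
    ∃ G, IsResidue (combo P f₀) (fun j => combo P (f j)) G := by
  set K : Set (ι → ℝ) := {ν | (∀ j, 0 ≤ ν j) ∧ ∑ j, ν j • f j ≤ f₀} with hK
  have hsum : ∀ ν ∈ K, ∑ j, ν j ≤ 1 := fun ν hν =>
    ((mem_feasible_iff hA hf₀ hf).2 hν).2.1
  have hcl : IsClosed K := by
    have : K = (⋂ j, {ν | 0 ≤ ν j}) ∩ {ν | ∑ j, ν j • f j ≤ f₀} := by
      ext ν; simp [hK]
    rw [this]
    refine (isClosed_iInter fun j => isClosed_le (by fun_prop) (by fun_prop)).inter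
      (isClosed_le (by fun_prop) (by fun_prop))
  have hcomp : IsCompact K := by
    refine isCompact_Icc (a := (0 : ι → ℝ)) (b := 1) |>.of_isClosed_subset hcl fun ν hν => ?_
    exact ⟨hν.1, fun j => (Finset.single_le_sum (f := ν) (fun j _ => hν.1 j)
      (Finset.mem_univ j)).trans (hsum ν hν)⟩
  obtain ⟨ν, hν, hmax⟩ := hcomp.exists_isMaxOn ⟨0, fun j => le_rfl, by
    simpa using (show 0 ≤ f₀ from hf₀.1)⟩ (f := fun ν => ∑ j, ν j) (by fun_prop)
  refine ⟨_, ν, (mem_feasible_iff hA hf₀ hf).2 hν, fun ν' hν' =>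
    hmax ((mem_feasible_iff hA hf₀ hf).1 hν'), fun h0 => ?_, rfl⟩
  refine hne ν (combo_injective hA ?_)
  obtain ⟨-, -, G, -, e⟩ := (mem_feasible_iff hA hf₀ hf).2 hν
  rw [e, h0, zero_smul, zero_add, sum_smul_combo]

theorem IsResidue.exists_coordinates (hA : JointlyIrreducible P) {ι : Type*} [Fintype ι]
    {f₀ : Fin L → ℝ} {f : ι → Fin L → ℝ} (hf₀ : f₀ ∈ stdSimplex ℝ (Fin L))
    (hf : ∀ j, f j ∈ stdSimplex ℝ (Fin L)) {G : SignedMeasure X}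
    (hG : IsResidue (combo P f₀) (fun j => combo P (f j)) G) :
    ∃ (ν : ι → ℝ) (g : Fin L → ℝ), g ∈ stdSimplex ℝ (Fin L) ∧ G = combo P g ∧
      ∑ j, ν j < 1 ∧ f₀ = (1 - ∑ j, ν j) • g + ∑ j, ν j • f j ∧
      ∀ ν' : ι → ℝ, (∀ j, 0 ≤ ν' j) → ∑ j, ν' j • f j ≤ f₀ → ∑ j, ν' j ≤ ∑ j, ν j := by
  obtain ⟨ν, hν, hmax, h0, rfl⟩ := hG
  have hlt : ∑ j, ν j < 1 := lt_of_le_of_ne hν.2.1 fun h => h0 (by rw [h, sub_self])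
  have e : (1 - ∑ j, ν j)⁻¹ • (combo P f₀ - ∑ j, ν j • combo P (f j)) =
      combo P ((1 - ∑ j, ν j)⁻¹ • (f₀ - ∑ j, ν j • f j)) := by
    rw [sum_smul_combo, ← map_sub, ← map_smul]
  refine ⟨ν, (1 - ∑ j, ν j)⁻¹ • (f₀ - ∑ j, ν j • f j), ?_, e, hlt, ?_, fun ν' h1 h2 =>
    hmax ν' ((mem_feasible_iff hA hf₀ hf).2 ⟨h1, h2⟩)⟩
  · obtain ⟨-, -, G, hG, e2⟩ := hν
    rw [← isDistribution_combo_iff hA, ← e, e2, add_sub_cancel_right, smul_smul,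
      inv_mul_cancel₀ h0, one_smul]
    exact hG
  · rw [smul_smul, mul_inv_cancel₀ h0, one_smul, sub_add_cancel]

theorem kappa_mem_Ioc_iff (hA : JointlyIrreducible P) {x y : Fin L → ℝ}
    (hx : x ∈ stdSimplex ℝ (Fin L)) (hy : y ∈ stdSimplex ℝ (Fin L)) :
    kappa (combo P x) (combo P y) ∈ Set.Ioc (0 : ℝ) 1 ↔ ∀ l, y l ≠ 0 → x l ≠ 0 := by
  have hset : {κ : ℝ | κ ∈ Set.Icc (0 : ℝ) 1 ∧ ∃ G : SignedMeasure X, IsDistribution G ∧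
      combo P x = (1 - κ) • G + κ • combo P y} = {κ | κ ∈ Set.Icc (0 : ℝ) 1 ∧ κ • y ≤ x} := by
    ext κ
    refine and_congr_right fun hκ => ?_
    have hs : ∑ l, (κ • y) l = κ := by
      simp only [Pi.smul_apply, smul_eq_mul]; rw [← Finset.mul_sum, hy.2, mul_one]
    have := exists_distribution_iff hA hx (h := κ • y) (hs.trans_le hκ.2)
    rwa [hs, map_smul] at this
  rw [kappa, hset]
  set K := {κ : ℝ | κ ∈ Set.Icc (0 : ℝ) 1 ∧ κ • y ≤ x} with hK
  have h0 : (0 : ℝ) ∈ K := ⟨⟨le_rfl, zero_le_one⟩, by simpa using (show 0 ≤ x from hx.1)⟩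
  have hbdd : BddAbove K := ⟨1, fun κ hκ => hκ.1.2⟩
  constructor
  · rintro ⟨hpos, -⟩ l hl hxl
    obtain ⟨κ, hκ, hκ0⟩ := exists_lt_of_lt_csSup ⟨0, h0⟩ hpos
    have := hκ.2 l
    simp only [Pi.smul_apply, smul_eq_mul, hxl] at this
    exact absurd (mul_pos hκ0 ((hy.1 l).lt_of_ne' hl)) this.not_gt
  · intro h
    refine ⟨?_, csSup_le ⟨0, h0⟩ fun κ hκ => hκ.1.2⟩
    obtain ⟨l₀, hl₀⟩ : ∃ l, x l ≠ 0 := by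
      by_contra! hall
      have := hx.2
      simp [hall] at this
    -- The smallest nonzero entry of `x` serves as `κ`, because the entries of `y` are at most one.
    obtain ⟨m, hm, hmin⟩ := Finset.exists_min_image (Finset.univ.filter fun l => x l ≠ 0) x
      ⟨l₀, by simpa using hl₀⟩
    have hm0 : x m ≠ 0 := by simpa using hm
    have hle1 : ∀ {z : Fin L → ℝ}, z ∈ stdSimplex ℝ (Fin L) → ∀ l, z l ≤ 1 := fun {z} hz l =>
      hz.2 ▸ Finset.single_le_sum (f := z) (fun l _ => hz.1 l) (Finset.mem_univ l)
    refine ((hx.1 m).lt_of_ne' hm0).trans_le (le_csSup hbdd ⟨⟨hx.1 m, hle1 hx m⟩, fun l => ?_⟩)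
    simp only [Pi.smul_apply, smul_eq_mul]
    by_cases hxl : x l = 0
    · have : y l = 0 := by_contra fun hyl => h l hyl hxl
      rw [this, hxl, mul_zero]
    · exact (mul_le_of_le_one_right (hx.1 m) (hle1 hy l)).trans (hmin l (by simpa using hxl))

end Coordinates

/-! ### Correctness of the vertex test -/

section VertexTest

variable {X : Type*} [MeasurableSpace X] {L : ℕ} {P : Fin L → ProbabilityMeasure X}

/-- For 0-1 vectors the entrywise minimum is the indicator of the intersection. -/
theorem foldl_inf_apply {ι α : Type*} (c : α → Prop) [DecidablePred c] (S : α → ι → ℝ)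
    (hS : ∀ a n, S a n = 0 ∨ S a n = 1) (n : ι) (l : List α) (r : ι → ℝ)
    (hr : r n = 0 ∨ r n = 1) :
    (l.foldl (fun r a => if c a then r ⊓ S a else r) r n = 0 ∨
      l.foldl (fun r a => if c a then r ⊓ S a else r) r n = 1) ∧
    (l.foldl (fun r a => if c a then r ⊓ S a else r) r n ≠ 0 ↔
      r n ≠ 0 ∧ ∀ a ∈ l, c a → S a n ≠ 0) := by
  induction l generalizing r with
  | nil => simpa using hr
  | cons a l ih =>
    rw [List.foldl_cons]
    have hr' : (if c a then r ⊓ S a else r) n = 0 ∨ (if c a then r ⊓ S a else r) n = 1 := by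
      split_ifs
      · rcases hr with h | h <;> rcases hS a n with h' | h' <;> simp [h, h']
      · exact hr
    refine ⟨(ih _ hr').1, (ih _ hr').2.trans ?_⟩
    have : (if c a then r ⊓ S a else r) n ≠ 0 ↔ r n ≠ 0 ∧ (c a → S a n ≠ 0) := by
      split_ifs with hc
      · rcases hr with h | h <;> rcases hS a n with h' | h' <;> simp [h, h', hc]
      · simp [hc]
    rw [this, and_assoc]
    simp

theorem partialLabelMatrix_eq (M : Matrix (Fin L) (Fin L) ℝ) (i j : Fin L) :
    partialLabelMatrix M i j = 0 ∨ partialLabelMatrix M i j = 1 := by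
  unfold partialLabelMatrix; split_ifs <;> simp

theorem partialLabelMatrix_ne_zero {M : Matrix (Fin L) (Fin L) ℝ}
    (hM : ∀ i, M i ∈ stdSimplex ℝ (Fin L)) (i j : Fin L) :
    partialLabelMatrix M i j ≠ 0 ↔ M i j ≠ 0 := by
  unfold partialLabelMatrix
  have := (hM i).1 j
  split_ifs with h
  · simp [h.ne']
  · simp [le_antisymm (not_lt.1 h) this]

theorem contaminated_eq (M : Matrix (Fin L) (Fin L) ℝ) :
    contaminated M P = fun i => combo P (M i) :=
  funext fun i => (combo_apply P (M i)).symm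

/-- Since `κ* > 0` means inclusion of supports, row `i` is the indicator of the intersection of the
supports of those rows of `M` that contain the support of `x i`. -/
theorem initialC_apply (hA : JointlyIrreducible P) {M : Matrix (Fin L) (Fin L) ℝ}
    (hM : ∀ i, M i ∈ stdSimplex ℝ (Fin L)) {x : Fin L → Fin L → ℝ}
    (hx : ∀ i, x i ∈ stdSimplex ℝ (Fin L)) (i n : Fin L) :
    (initialC (partialLabelMatrix M) (contaminated M P) (fun i => combo P (x i)) i n = 0 ∨
      initialC (partialLabelMatrix M) (contaminated M P) (fun i => combo P (x i)) i n = 1) ∧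
    (initialC (partialLabelMatrix M) (contaminated M P) (fun i => combo P (x i)) i n ≠ 0 ↔
      ∀ j, (∀ l, x i l ≠ 0 → M j l ≠ 0) → M j n ≠ 0) := by
  classical
  have h := foldl_inf_apply (fun j => kappa (combo P (M j)) (combo P (x i)) ∈ Set.Ioc (0 : ℝ) 1)
    (partialLabelMatrix M) (partialLabelMatrix_eq M) n (List.finRange L) (fun _ => 1) (Or.inr rfl)
  rw [contaminated_eq]
  unfold initialC
  refine ⟨by convert h.1, ?_⟩
  have h2 := h.2
  simp only [ne_eq, one_ne_zero, not_false_eq_true, List.mem_finRange, true_and,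
    forall_const, kappa_mem_Ioc_iff hA (hM _) (hx i)] at h2
  simp only [← ne_eq, partialLabelMatrix_ne_zero hM] at h2
  rw [← h2]
  simp only [kappa_mem_Ioc_iff hA (hM _) (hx i)]

/-- A property that survives every single resolution survives all passes. -/
theorem resolvePass_iterate_induction {p : Matrix (Fin L) (Fin L) ℝ → Prop}
    (hp : ∀ C i, p C → p (resolveRow C i)) {C : Matrix (Fin L) (Fin L) ℝ} (hC : p C) (t : ℕ) :
    p (resolvePass^[t] C) := by
  have hfold : ∀ (l : List (Fin L)) C, p C → p (l.foldl resolveRow C) := by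
    intro l
    induction l with
    | nil => exact fun C h => h
    | cons a l ih => exact fun C h => ih _ (hp C a h)
  induction t with
  | zero => exact hC
  | succ t ih => rw [Function.iterate_succ_apply']; exact hfold _ _ ih

theorem eq_single_of_support {x : Fin L → ℝ} (hx : x ∈ stdSimplex ℝ (Fin L)) {j : Fin L}
    (h : ∀ n, x n ≠ 0 → n = j) : x = Pi.single j 1 := by
  have h0 : ∀ n, n ≠ j → x n = 0 := fun n hn => by_contra fun hc => hn (h n hc)
  have h1 : x j = 1 := by
    rw [← hx.2, Finset.sum_eq_single j (fun n _ hn => h0 n hn) (by simp)]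
  funext n
  by_cases hn : n = j
  · rw [hn, h1, Pi.single_eq_same]
  · rw [h0 n hn, Pi.single_eq_of_ne hn]

theorem permMatrix_apply_eq (σ : Equiv.Perm (Fin L)) (i j : Fin L) :
    σ.permMatrix ℝ i j = if σ i = j then 1 else 0 := by
  simp [Equiv.Perm.permMatrix, PEquiv.toMatrix_apply, eq_comm]

/-- If the vertex test succeeds, then it recovers `P`. -/
theorem mix_of_vertexTest_eq_true (hA : JointlyIrreducible P) {M : Matrix (Fin L) (Fin L) ℝ}
    (hM : ∀ i, M i ∈ stdSimplex ℝ (Fin L)) {x : Fin L → Fin L → ℝ}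
    (hx : ∀ i, x i ∈ stdSimplex ℝ (Fin L)) {C : Matrix (Fin L) (Fin L) ℝ}
    (h : vertexTest (partialLabelMatrix M) (contaminated M P) (fun i => combo P (x i)) =
      (true, C)) (i : Fin L) :
    mix C (fun i => combo P (x i)) i = distr (P i) := by
  classical
  unfold vertexTest at h
  split_ifs at h with hk
  · simp at h
  simp only at h
  split_ifs at h with hσ
  swap
  · simp at h
  obtain ⟨σ, hσ⟩ := hσ
  rw [hσ] at h
  simp only [Prod.mk.injEq, true_and] at h
  simp only [kappa_mem_Ioc_iff hA (hx _) (hx _)] at hk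
  -- Invariant: the support of `x i` lies in that of row `i` of `C`. When row `i` is `e_j`, the
  -- support of `x i` is `{j}`; another candidate charging `j` would have a larger support, contrary
  -- to `hk`. So column `j` can be cleared outside row `i`.
  have hinv := resolvePass_iterate_induction
    (p := fun C : Matrix (Fin L) (Fin L) ℝ => ∀ i n, x i n ≠ 0 → C i n ≠ 0) (fun C i hC => by
      unfold resolveRow
      split_ifs with hj
      · have hj' := hj.choose_spec
        set j := hj.choose
        intro i' n hn
        rw [Matrix.updateCol_apply]
        split_ifs with hnj
        · by_cases hi : i' = i
          · simp [hi]
          · refine absurd ⟨i', i, hi, fun l hl => ?_⟩ hk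
            have : l = j := by
              by_contra hlj
              refine hC i l hl ?_
              rw [hj', Pi.single_eq_of_ne hlj]
            rwa [this, ← hnj]
        · exact hC i' n hn
      · exact hC)
    (fun i n hn => ((initialC_apply hA hM hx i n).2.2 fun j hj => hj n hn)) L
  rw [hσ] at hinv
  have hxs : ∀ i, x i = Pi.single (σ i) 1 := fun i => eq_single_of_support (hx i) fun n hn => by
    by_contra hne
    exact hinv i n hn (by rw [permMatrix_apply_eq, if_neg (Ne.symm hne)])
  unfold mix
  rw [← h, Finset.sum_eq_single (σ.symm i)]
  · rw [Matrix.transpose_apply, permMatrix_apply_eq]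
    simp [hxs, combo_single]
  · intro j _ hj
    rw [Matrix.transpose_apply, permMatrix_apply_eq, if_neg, zero_smul]
    rintro rfl
    simp at hj
  · simp

/-- The vertex test succeeds on every permutation of `P`. -/
theorem vertexTest_single (hA : JointlyIrreducible P) {M : Matrix (Fin L) (Fin L) ℝ}
    (hM : ∀ i, M i ∈ stdSimplex ℝ (Fin L))
    (hC : ∀ j j', (∀ i, partialLabelMatrix M i j = partialLabelMatrix M i j') → j = j')
    (σ : Equiv.Perm (Fin L)) :
    (vertexTest (partialLabelMatrix M) (contaminated M P)
      (fun i => combo P (Pi.single (σ i) 1))).1 = true := by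
  classical
  have hx : ∀ i, (Pi.single (σ i) 1 : Fin L → ℝ) ∈ stdSimplex ℝ (Fin L) :=
    fun i => single_mem_stdSimplex ℝ (σ i)
  unfold vertexTest
  rw [if_neg]
  swap
  · rintro ⟨i, j, hij, h⟩
    rw [kappa_mem_Ioc_iff hA (hx i) (hx j)] at h
    refine h (σ j) (by simp) (Pi.single_eq_of_ne ?_ _)
    exact fun h => hij (σ.injective h).symm
  set C₀ := initialC (partialLabelMatrix M) (contaminated M P)
    (fun i => combo P (Pi.single (σ i) 1)) with hC₀
  have hC01 : ∀ i n, C₀ i n = 0 ∨ C₀ i n = 1 := fun i n => (initialC_apply hA hM hx i n).1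
  have hC₀iff : ∀ i n, C₀ i n ≠ 0 ↔ ∀ j, M j (σ i) ≠ 0 → M j n ≠ 0 := fun i n => by
    rw [hC₀, (initialC_apply hA hM hx i n).2]
    refine forall_congr' fun j => imp_congr_left ⟨fun h => h _ (by simp), fun h l hl => ?_⟩
    have : l = σ i := by by_contra hne; exact hl (Pi.single_eq_of_ne hne _)
    rwa [this]
  -- columns are ordered by inclusion; `above n` are the columns that contain column `n`
  set above : Fin L → Finset (Fin L) := fun n =>
    Finset.univ.filter fun n' => n' ≠ n ∧ ∀ j, M j n ≠ 0 → M j n' ≠ 0 with habove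
  -- Antisymmetry of inclusion is where the distinctness of the columns enters.
  have hanti : ∀ n n', (∀ j, M j n ≠ 0 → M j n' ≠ 0) → (∀ j, M j n' ≠ 0 → M j n ≠ 0) →
      n = n' := fun n n' h h' => hC n n' fun i => by
    have e : partialLabelMatrix M i n ≠ 0 ↔ partialLabelMatrix M i n' ≠ 0 := by
      rw [partialLabelMatrix_ne_zero hM, partialLabelMatrix_ne_zero hM]
      exact ⟨h i, h' i⟩
    rcases partialLabelMatrix_eq M i n with h1 | h1 <;>
      rcases partialLabelMatrix_eq M i n' with h2 | h2 <;> simp [h1, h2] at e ⊢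
  have habove_lt : ∀ n, ∀ n' ∈ above n, (above n').card < (above n).card := by
    intro n n' hn'
    simp only [habove, Finset.mem_filter, Finset.mem_univ, true_and] at hn'
    refine Finset.card_lt_card ⟨fun m hm => ?_, fun hsub => ?_⟩
    · simp only [habove, Finset.mem_filter, Finset.mem_univ, true_and] at hm ⊢
      refine ⟨?_, fun j hj => hm.2 j (hn'.2 j hj)⟩
      rintro rfl
      exact hn'.1 (hanti _ _ hm.2 hn'.2)
    · have := hsub (show n' ∈ above n by simpa [habove] using hn')
      simp [habove] at this
  let resolved : Matrix (Fin L) (Fin L) ℝ → Fin L → Prop := fun C n =>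
    ∀ i, C i n = if σ i = n then 1 else 0
  -- Each column is either in its final form or untouched since the start.
  let inv : Matrix (Fin L) (Fin L) ℝ → Prop := fun C => ∀ n, resolved C n ∨ ∀ i, C i n = C₀ i n
  have hdiag : ∀ C, inv C → ∀ i, C i (σ i) = 1 := fun C h i => by
    rcases h (σ i) with h | h
    · rw [h i, if_pos rfl]
    · rw [h i]
      exact (hC01 i (σ i)).resolve_left ((hC₀iff i (σ i)).2 fun j hj => hj)
  -- a resolution either does nothing or resolves the column of the vertex in question
  have hstep : ∀ C i, inv C → resolveRow C i = C ∨
      (C i = Pi.single (σ i) 1 ∧ resolveRow C i = C.updateCol (σ i) (Pi.single i 1)) := by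
    intro C i hinv
    unfold resolveRow
    split_ifs with hj
    · right
      have hj' := hj.choose_spec
      have : hj.choose = σ i := by
        by_contra hne
        have h1 := hdiag C hinv i
        rw [hj', Pi.single_eq_of_ne (Ne.symm hne)] at h1
        exact zero_ne_one h1
      rw [this] at hj' ⊢
      exact ⟨hj', rfl⟩
    · exact Or.inl rfl
  have hupd : ∀ C i, resolved (Matrix.updateCol C (σ i) (Pi.single i 1)) (σ i) := by
    intro C i i'
    rw [Matrix.updateCol_self, Pi.single_apply]
    simp
  have hmono : ∀ C i n, inv C → resolved C n → resolved (resolveRow C i) n := by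
    intro C i n hinv hr
    rcases hstep C i hinv with h | ⟨-, h⟩
    · rwa [h]
    · rw [h]
      by_cases hn : n = σ i
      · rw [hn]; exact hupd C i
      · intro i'
        rw [Matrix.updateCol_ne hn]
        exact hr i'
  have hinv_step : ∀ C i, inv C → inv (resolveRow C i) := by
    intro C i hinv n
    rcases hinv n with hr | h0
    · exact Or.inl (hmono C i n hinv hr)
    rcases hstep C i hinv with h | ⟨-, h⟩
    · rw [h]; exact Or.inr h0
    · rw [h]
      by_cases hn : n = σ i
      · rw [hn]; exact Or.inl (hupd C i)
      · exact Or.inr fun i' => by rw [Matrix.updateCol_ne hn, h0 i']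
  -- Row `σ.symm n` initially charges only `n` and the columns above `n`. Once the latter are
  -- resolved, the row is `e_n` and the update applies.
  have hready : ∀ C n, inv C → (∀ n' ∈ above n, resolved C n') →
      resolved (resolveRow C (σ.symm n)) n := by
    intro C n hinv hab
    by_cases hrn : resolved C n
    · exact hmono C _ n hinv hrn
    have hrow : C (σ.symm n) = Pi.single n 1 := by
      funext n'
      by_cases hn' : n' = n
      · have := hdiag C hinv (σ.symm n)
        rw [σ.apply_symm_apply] at this
        rw [hn', this, Pi.single_eq_same]
      · rw [Pi.single_eq_of_ne hn']
        by_cases hmem : n' ∈ above n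
        · rw [hab n' hmem, σ.apply_symm_apply, if_neg (Ne.symm hn')]
        · rcases hinv n' with h | h
          · rw [h, σ.apply_symm_apply, if_neg (Ne.symm hn')]
          · rw [h]
            by_contra hne
            have h2 := (hC₀iff _ _).1 hne
            rw [σ.apply_symm_apply] at h2
            exact hmem (by simpa [habove] using ⟨hn', h2⟩)
    rcases hstep C (σ.symm n) hinv with h | ⟨-, h⟩
    · unfold resolveRow at h
      have hex : ∃ j, C (σ.symm n) = Pi.single j 1 := ⟨n, hrow⟩
      rw [dif_pos hex] at h
      have : hex.choose = n := by
        have h3 := hex.choose_spec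
        by_contra hne
        have h4 := congrFun (hrow.symm.trans h3) n
        rw [Pi.single_eq_same, Pi.single_eq_of_ne (Ne.symm hne)] at h4
        exact one_ne_zero h4
      rw [this] at h
      refine absurd (fun i => ?_) hrn
      rw [← h, Matrix.updateCol_self, Pi.single_apply]
      simp [Equiv.eq_symm_apply]
    · have := hupd C (σ.symm n)
      rw [← h, σ.apply_symm_apply] at this
      exact this
  have hfold : ∀ (l : List (Fin L)) C, inv C → inv (l.foldl resolveRow C) ∧
      (∀ n, resolved C n → resolved (l.foldl resolveRow C) n) ∧
      ∀ n, (∀ n' ∈ above n, resolved C n') → σ.symm n ∈ l →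
        resolved (l.foldl resolveRow C) n := by
    intro l
    induction l with
    | nil => exact fun C h => ⟨h, fun n hn => hn, by simp⟩
    | cons a l ih =>
      intro C h
      obtain ⟨h1, h2, h3⟩ := ih _ (hinv_step C a h)
      refine ⟨h1, fun n hn => h2 n (hmono C a n h hn), fun n hab hmem => ?_⟩
      rcases List.mem_cons.1 hmem with rfl | hmem
      · exact h2 n (hready C n h hab)
      · exact h3 n (fun n' hn' => hmono C a n' h (hab n' hn')) hmem
  -- Each pass resolves one more level of the inclusion order; there are at most `L` levels, hence
  -- `L` passes suffice.
  have hpass : ∀ t, inv (resolvePass^[t] C₀) ∧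
      ∀ n, (above n).card < t → resolved (resolvePass^[t] C₀) n := by
    intro t
    induction t with
    | zero => exact ⟨fun n => Or.inr fun i => rfl, by simp⟩
    | succ t ih =>
      rw [Function.iterate_succ_apply']
      obtain ⟨h1, -, h3⟩ := hfold (List.finRange L) _ ih.1
      refine ⟨h1, fun n hn => h3 n (fun n' hn' => ih.2 n' ?_) (List.mem_finRange _)⟩
      have := habove_lt n n' hn'
      omega
  have hcard : ∀ n, (above n).card < L := fun n => by
    have : above n ⊂ Finset.univ :=
      ⟨Finset.subset_univ _, fun h => by simpa [habove] using h (Finset.mem_univ n)⟩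
    simpa using Finset.card_lt_card this
  have hfin : resolvePass^[L] C₀ = σ.permMatrix ℝ := by
    ext i n
    rw [permMatrix_apply_eq]
    exact (hpass L).2 n (hcard n) i
  simp only
  rw [if_pos ⟨σ, hfin⟩]

end VertexTest

/-! ### Generic draws -/

section Generic

open Matrix

theorem ae_uniformSimplex_mem (L : ℕ) : ∀ᵐ x ∂(uniformSimplex L), x ∈ stdSimplex ℝ (Fin L) :=
  ae_cond_mem (isClosed_stdSimplex ℝ (Fin L)).measurableSet

/-- Proper hyperplanes through the origin are null for the uniform distribution on the simplex. -/
theorem ae_uniformSimplex_dotProduct_ne {L : ℕ} (hL : 1 ≤ L) {v : Fin L → ℝ} (hv : v ≠ 0) :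
    ∀ᵐ x ∂(uniformSimplex L), x ⬝ᵥ v ≠ 0 := by
  obtain ⟨n, rfl⟩ := Nat.exists_eq_add_of_le' hL
  have habs : uniformSimplex (n + 1) ≪ (Measure.hausdorffMeasure (n : ℝ)).restrict
      (stdSimplex ℝ (Fin (n + 1))) := by
    unfold uniformSimplex
    rw [show ((n + 1 : ℕ) : ℝ) - 1 = n by push_cast; ring]
    exact Measure.smul_absolutelyContinuous
  refine Filter.Eventually.filter_mono habs.ae_le ?_
  rw [ae_restrict_iff' (isClosed_stdSimplex ℝ (Fin (n + 1))).measurableSet, ae_iff]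
  -- The simplex lies in the graph of an affine map over the last `n` coordinates. A Lipschitz
  -- parametrization carries null sets to null sets of `n`-dimensional Hausdorff measure.
  have he : LipschitzWith (n + 1)
      (fun x : Fin n → ℝ => (Fin.cons (1 - ∑ i, x i) x : Fin (n + 1) → ℝ)) := by
    refine LipschitzWith.of_dist_le_mul fun x y => ?_
    refine (dist_pi_le_iff (by positivity)).2 fun i => ?_
    refine Fin.cases ?_ (fun j => ?_) i
    · simp only [Fin.cons_zero, Real.dist_eq]
      have : |(1 - ∑ i, x i) - (1 - ∑ i, y i)| = |∑ i, (y i - x i)| := by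
        rw [Finset.sum_sub_distrib]; congr 1; ring
      rw [this]
      refine (Finset.abs_sum_le_sum_abs _ _).trans ?_
      have h1 : ∀ i ∈ Finset.univ, |y i - x i| ≤ dist x y := fun i _ => by
        rw [abs_sub_comm]; exact dist_le_pi_dist x y i
      refine (Finset.sum_le_sum h1).trans ?_
      simp
      nlinarith [dist_nonneg (x := x) (y := y)]
    · simp only [Fin.cons_succ]
      refine (dist_le_pi_dist x y j).trans ?_
      push_cast
      nlinarith [dist_nonneg (x := x) (y := y), (Nat.cast_nonneg n : (0 : ℝ) ≤ n)]
  -- the hyperplane in the chart that forgets the first coordinate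
  set N : Set (Fin n → ℝ) := {x | v 0 + ∑ i, x i * (v i.succ - v 0) = 0} with hN
  have hN0 : volume N = 0 := by
    -- If `v` is constant, `x ⬝ᵥ v` is that nonzero constant wherever the coordinates sum to one.
    -- Otherwise `N` is a proper affine subspace.
    by_cases hc : ∀ i : Fin n, v i.succ = v 0
    · have : N = ∅ := by
        ext x
        simp only [hN, Set.mem_ofPred_eq, Set.mem_empty_iff_false, iff_false]
        simp only [hc, sub_self, mul_zero, Finset.sum_const_zero, add_zero]
        intro h0
        exact hv (funext fun i => Fin.cases h0 (fun j => (hc j).trans h0) i)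
      rw [this, measure_empty]
    · push Not at hc
      obtain ⟨i, hi⟩ := hc
      let φ : (Fin n → ℝ) →ₗ[ℝ] ℝ := Fintype.linearCombination ℝ (fun i => v i.succ - v 0)
      have hφ : ∀ x, φ x = ∑ i, x i * (v i.succ - v 0) := fun x => by
        simp [φ, Fintype.linearCombination_apply]
      let A : AffineSubspace ℝ (Fin n → ℝ) :=
        (AffineSubspace.mk' (-v 0) (⊥ : Submodule ℝ ℝ)).comap φ.toAffineMap
      have hA : N = A := by
        ext x
        simp only [hN, Set.mem_ofPred_eq, A, AffineSubspace.coe_comap, Set.mem_preimage,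
          LinearMap.coe_toAffineMap, SetLike.mem_coe, AffineSubspace.mem_mk', vsub_eq_sub,
          Submodule.mem_bot, hφ]
        constructor <;> intro h <;> linarith
      rw [hA]
      refine Measure.addHaar_affineSubspace _ _ fun htop => ?_
      have h1 : ∀ x, x ∈ N := fun x => by rw [hA, htop]; trivial
      have e1 := h1 0
      have e2 := h1 (Pi.single i 1)
      simp only [hN, Set.mem_ofPred_eq, Pi.zero_apply, zero_mul, Finset.sum_const_zero, add_zero,
        Pi.single_apply, ite_mul, one_mul, Finset.sum_ite_eq', Finset.mem_univ, if_true] at e1 e2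
      exact hi (by linarith)
  have hvol : (Measure.hausdorffMeasure (n : ℝ) : Measure (Fin n → ℝ)) = volume := by
    simpa using hausdorffMeasure_pi_real (ι := Fin n)
  refine measure_mono_null (t := (fun x : Fin n → ℝ =>
    (Fin.cons (1 - ∑ i, x i) x : Fin (n + 1) → ℝ)) '' N) ?_ ?_
  · intro x hx
    simp only [ne_eq, Set.mem_ofPred_eq, Classical.not_imp, not_not] at hx
    obtain ⟨⟨-, hs⟩, h0⟩ := hx
    rw [Fin.sum_univ_succ] at hs
    have hx0 : x 0 = 1 - ∑ i : Fin n, x i.succ := by linarith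
    refine ⟨fun i => x i.succ, ?_, ?_⟩
    · simp only [dotProduct, Fin.sum_univ_succ] at h0
      simp only [hN, Set.mem_ofPred_eq, mul_sub, Finset.sum_sub_distrib, ← Finset.sum_mul]
      rw [hx0] at h0
      linarith
    · ext i
      refine Fin.cases ?_ (fun j => ?_) i
      · simp [hx0]
      · simp
  · refine le_antisymm ((he.hausdorffMeasure_image_le (Nat.cast_nonneg n) N).trans ?_) zero_le
    rw [hvol, hN0, mul_zero]

/-- Redrawing one coordinate of a random vector with independent coordinates does not change its
law. -/
theorem measurePreserving_update {ι α : Type*} [Fintype ι] [DecidableEq ι] [MeasurableSpace α]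
    (μ : Measure α) [IsProbabilityMeasure μ] (r : ι) :
    MeasurePreserving (fun p : (ι → α) × α => Function.update p.1 r p.2)
      ((Measure.pi fun _ => μ).prod μ) (Measure.pi fun _ => μ) := by
  have hmeas : Measurable (fun p : (ι → α) × α => Function.update p.1 r p.2) := by
    refine measurable_pi_iff.2 fun j => ?_
    by_cases hj : j = r
    · subst hj; simpa using measurable_snd
    · simpa [Function.update_of_ne hj, Function.comp_def] using
        (measurable_pi_apply j).comp measurable_fst
  refine ⟨hmeas, (Measure.pi_eq fun s hs => ?_).symm⟩
  rw [Measure.map_apply hmeas (MeasurableSet.univ_pi hs)]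
  have : (fun p : (ι → α) × α => Function.update p.1 r p.2) ⁻¹' Set.univ.pi s =
      (Set.univ.pi (Function.update s r Set.univ)) ×ˢ s r := by
    ext ⟨w, x⟩
    simp only [Set.mem_preimage, Set.mem_univ_pi, Set.mem_prod]
    constructor
    · refine fun h => ⟨fun j => ?_, by simpa using h r⟩
      by_cases hj : j = r
      · subst hj; simp
      · simpa [Function.update_of_ne hj] using h j
    · rintro ⟨h1, h2⟩ j
      by_cases hj : j = r
      · subst hj; simpa using h2
      · simpa [Function.update_of_ne hj] using h1 j
  rw [this, Measure.prod_prod, Measure.pi_pi,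
    ← Finset.prod_erase_mul Finset.univ (fun i => μ (s i)) (Finset.mem_univ r),
    ← Finset.prod_erase_mul Finset.univ _ (Finset.mem_univ r)]
  simp only [Function.update_self, measure_univ, mul_one]
  congr 1
  refine Finset.prod_congr rfl fun j hj => ?_
  rw [Function.update_of_ne (Finset.ne_of_mem_erase hj)]

/-- Replacing rows of an invertible matrix by random rows keeps it invertible almost surely. -/
theorem ae_det_ne_zero {L : ℕ} (hL : 1 ≤ L) {M : Matrix (Fin L) (Fin L) ℝ} (hM : M.det ≠ 0)
    {A : Matrix (Fin L) (Fin L) ℝ} (hA : A.det ≠ 0) (s : Finset (Fin L)) :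
    ∀ᵐ w ∂(drawLaw L),
      (Matrix.of fun r j => if r ∈ s then (w r ᵥ* M) j else A r j).det ≠ 0 := by
  have := isProbabilityMeasure_uniformSimplex L hL
  induction s using Finset.induction_on with
  | empty =>
    refine Filter.Eventually.of_forall fun w => ?_
    simp only [Finset.notMem_empty, if_false]
    exact hA
  | insert r s hr ih =>
    have hcont : Continuous fun w : Fin L → Fin L → ℝ =>
        (Matrix.of fun r' j => if r' ∈ insert r s then (w r' ᵥ* M) j else A r' j).det := by
      refine Continuous.matrix_det (continuous_matrix fun i j => ?_)
      simp only [Matrix.of_apply]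
      split_ifs
      · simp only [Matrix.vecMul, dotProduct]
        fun_prop
      · fun_prop
    have hmeas : MeasurableSet {w : Fin L → Fin L → ℝ |
        (Matrix.of fun r' j => if r' ∈ insert r s then (w r' ᵥ* M) j else A r' j).det ≠ 0} :=
      (isOpen_ne_fun hcont continuous_const).measurableSet
    have hmp := measurePreserving_update (uniformSimplex L) r
    have heq : ∀ (w : Fin L → Fin L → ℝ) (x : Fin L → ℝ), (Matrix.of fun r' j => if r' ∈ insert r s
        then (Function.update w r x r' ᵥ* M) j else A r' j) =
        (Matrix.of fun r j => if r ∈ s then (w r ᵥ* M) j else A r j).updateRow r (x ᵥ* M) := by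
      intro w x
      ext r' j
      by_cases hr' : r' = r
      · subst hr'
        rw [Matrix.updateRow_self, Matrix.of_apply, if_pos (Finset.mem_insert_self _ _),
          Function.update_self]
      · rw [Matrix.updateRow_ne hr', Matrix.of_apply, Matrix.of_apply, Function.update_of_ne hr']
        simp [hr']
    unfold drawLaw at ih ⊢
    -- Row `r` is redrawn as an independent `x`. For fixed `w`, the determinant is then linear in
    -- `x`, so a null hyperplane has to be avoided.
    rw [← hmp.map_eq, ae_map_iff hmp.measurable.aemeasurable hmeas]
    refine (Measure.ae_prod_iff_ae_ae (hmp.measurable hmeas)).2 ?_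
    filter_upwards [ih] with w hw
    set B : Matrix (Fin L) (Fin L) ℝ :=
      Matrix.of fun r j => if r ∈ s then (w r ᵥ* M) j else A r j with hB
    let φ : (Fin L → ℝ) →ₗ[ℝ] ℝ :=
      (Matrix.detRowAlternating (n := Fin L) (R := ℝ)).toMultilinearMap.toLinearMap B r
    have hφ : ∀ u, φ u = (B.updateRow r u).det := fun u => rfl
    have hφM : ∀ x, φ (x ᵥ* M) = x ⬝ᵥ fun l => φ (M l) := by
      intro x
      rw [Matrix.vecMul_eq_sum, map_sum]
      simp [dotProduct]
    -- The rows of `M` span, so if `φ` killed them all it would kill `B r`, where its value is `det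
    -- B ≠ 0`.
    have hv : (fun l => φ (M l)) ≠ 0 := by
      intro h0
      have h1 : φ (B r) = 0 := by
        have h2 : B r = (B r ᵥ* M⁻¹) ᵥ* M := by
          rw [Matrix.vecMul_vecMul, Matrix.nonsing_inv_mul M (isUnit_iff_ne_zero.2 hM),
            Matrix.vecMul_one]
        rw [h2, hφM, h0, dotProduct_zero]
      rw [hφ, Matrix.updateRow_eq_self] at h1
      exact hw h1
    filter_upwards [ae_uniformSimplex_dotProduct_ne hL hv] with x hx
    exact fun h0 => hx (by rw [← hφM, hφ, hB, ← heq]; exact h0)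

end Generic

/-! ### The geometry of one update -/

section Update

open Matrix Filter Topology

variable {L : ℕ}

/-- The coordinates of `target`, the candidates and draws in use being the rows of `A`. -/
noncomputable def targetCoord (k : ℕ) (A : Fin L → Fin L → ℝ) (i : Fin L) : Fin L → ℝ :=
  (1 / (k : ℝ)) • A i + (1 - 1 / (k : ℝ)) • ((1 / ((L : ℝ) - 1)) • ∑ j : {j // j ≠ i}, A j)

theorem targetCoord_mem (hL : 2 ≤ L) {k : ℕ} (hk : 1 ≤ k) {A : Fin L → Fin L → ℝ}
    (hA : ∀ r, A r ∈ stdSimplex ℝ (Fin L)) (i : Fin L) :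
    targetCoord k A i ∈ stdSimplex ℝ (Fin L) := by
  have hL' : (0 : ℝ) < (L : ℝ) - 1 := by
    have : (2 : ℝ) ≤ L := by exact_mod_cast hL
    linarith
  have hk' : (1 : ℝ) ≤ k := by exact_mod_cast hk
  have hk0 : (0 : ℝ) ≤ 1 / k := by positivity
  have hk1 : 1 / (k : ℝ) ≤ 1 := by rw [div_le_one (by linarith)]; exact hk'
  have havg : (1 / ((L : ℝ) - 1)) • ∑ j : {j // j ≠ i}, A j ∈ stdSimplex ℝ (Fin L) := by
    rw [Finset.smul_sum]
    refine (convex_stdSimplex ℝ (Fin L)).sum_mem (fun _ _ => by positivity) ?_ fun j _ => hA j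
    have hcard : Fintype.card {j // j ≠ i} = L - 1 := by simp
    rw [Finset.sum_const, Finset.card_univ, hcard, nsmul_eq_mul, Nat.cast_sub (by omega),
      Nat.cast_one, mul_one_div, div_self hL'.ne']
  exact (convex_stdSimplex ℝ (Fin L)) (hA i) havg hk0 (sub_nonneg.2 hk1) (by ring)

/-- `ℓ` is the functional dual to the `i`-th row of `A`. -/
def IsDual (A : Fin L → Fin L → ℝ) (i : Fin L) (l : Fin L → ℝ) : Prop :=
  ∀ r, A r ⬝ᵥ l = if r = i then 1 else 0

theorem exists_isDual {A : Fin L → Fin L → ℝ} (hA : (Matrix.of A).det ≠ 0) (i : Fin L) :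
    ∃ l, IsDual A i l := by
  refine ⟨(Matrix.of A)⁻¹ *ᵥ Pi.single i 1, fun r => ?_⟩
  have h : (Matrix.of A) *ᵥ ((Matrix.of A)⁻¹ *ᵥ Pi.single i 1) = Pi.single i (1 : ℝ) := by
    rw [Matrix.mulVec_mulVec, Matrix.mul_nonsing_inv _ (isUnit_iff_ne_zero.2 hA),
      Matrix.one_mulVec]
  exact (congrFun h r).trans (Pi.single_apply ..)

theorem exists_row_combination {A : Fin L → Fin L → ℝ} (hA : (Matrix.of A).det ≠ 0)
    (u : Fin L → ℝ) : ∃ c : Fin L → ℝ, u = ∑ r, c r • A r := by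
  refine ⟨u ᵥ* (Matrix.of A)⁻¹, ?_⟩
  have h : (u ᵥ* (Matrix.of A)⁻¹) ᵥ* (Matrix.of A) = u := by
    rw [Matrix.vecMul_vecMul, Matrix.nonsing_inv_mul _ (isUnit_iff_ne_zero.2 hA),
      Matrix.vecMul_one]
  rw [Matrix.vecMul_eq_sum] at h
  exact h.symm

theorem IsDual.sum_smul_dotProduct {A : Fin L → Fin L → ℝ} {i : Fin L} {l : Fin L → ℝ}
    (h : IsDual A i l) (c : Fin L → ℝ) : (∑ r, c r • A r) ⬝ᵥ l = c i := by
  simp [sum_dotProduct, smul_dotProduct, h _]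

theorem IsDual.sum_subtype_dotProduct {A : Fin L → Fin L → ℝ} {i : Fin L} {l : Fin L → ℝ}
    (h : IsDual A i l) (c : {j // j ≠ i} → ℝ) : (∑ j, c j • A j) ⬝ᵥ l = 0 := by
  rw [sum_dotProduct]
  refine Finset.sum_eq_zero fun j _ => ?_
  rw [smul_dotProduct, h j, if_neg j.2, smul_zero]

/-- Cramer's rule: `u ⬝ᵥ l` is the `i`-th coefficient of `u` in the basis of rows of `A`. -/
theorem IsDual.det_update {A : Fin L → Fin L → ℝ} (hA : (Matrix.of A).det ≠ 0) {i : Fin L}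
    {l : Fin L → ℝ} (h : IsDual A i l) (u : Fin L → ℝ) :
    (Matrix.of (Function.update A i u)).det = (u ⬝ᵥ l) * (Matrix.of A).det := by
  obtain ⟨c, rfl⟩ := exists_row_combination hA u
  rw [h.sum_smul_dotProduct]
  exact Matrix.det_updateRow_sum (Matrix.of A) i c

theorem IsDual.targetCoord_dotProduct {A : Fin L → Fin L → ℝ} {i : Fin L} {l : Fin L → ℝ}
    (h : IsDual A i l) (k : ℕ) : targetCoord k A i ⬝ᵥ l = 1 / k := by
  have := h.sum_subtype_dotProduct fun _ => 1
  simp only [one_smul] at this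
  rw [targetCoord, add_dotProduct, smul_dotProduct, smul_dotProduct, smul_dotProduct, this, h i]
  simp

theorem targetCoord_ne_sum {A : Fin L → Fin L → ℝ} (hA : (Matrix.of A).det ≠ 0) {k : ℕ}
    (hk : 1 ≤ k) (i : Fin L) (ν : {j // j ≠ i} → ℝ) : targetCoord k A i ≠ ∑ j, ν j • A j := by
  obtain ⟨l, hl⟩ := exists_isDual hA i
  intro h
  have h1 := hl.targetCoord_dotProduct k
  rw [h, hl.sum_subtype_dotProduct] at h1
  have : (0 : ℝ) < 1 / k := by positivity
  exact this.ne h1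

/-- With `t = 1 - ∑ ν`, the product is fixed, so maximizing `∑ ν` is the same as maximizing `g ⬝ᵥ
l`. -/
theorem IsDual.residue_dotProduct {A : Fin L → Fin L → ℝ} {i : Fin L} {l : Fin L → ℝ}
    (hl : IsDual A i l) {k : ℕ} {ν : {j // j ≠ i} → ℝ} {g : Fin L → ℝ} {t : ℝ}
    (h : targetCoord k A i = t • g + ∑ j, ν j • A j) : t * (g ⬝ᵥ l) = 1 / k := by
  rw [← hl.targetCoord_dotProduct k, h, add_dotProduct, hl.sum_subtype_dotProduct,
    smul_dotProduct, add_zero, smul_eq_mul]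

/-- This holds for every `k ≥ 1`, so the rows in use remain a basis also in the early rounds, where
residues need not be vertices. -/
theorem det_update_residue_ne_zero {A : Fin L → Fin L → ℝ} (hA : (Matrix.of A).det ≠ 0) {k : ℕ}
    (hk : 1 ≤ k) {i : Fin L} {ν : {j // j ≠ i} → ℝ} {g : Fin L → ℝ} {t : ℝ}
    (h : targetCoord k A i = t • g + ∑ j, ν j • A j) :
    (Matrix.of (Function.update A i g)).det ≠ 0 := by
  obtain ⟨l, hl⟩ := exists_isDual hA i
  rw [hl.det_update hA]
  have h1 := hl.residue_dotProduct h
  have : (0 : ℝ) < 1 / k := by positivity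
  exact mul_ne_zero (right_ne_zero_of_mul (h1.trans_ne this.ne')) hA

/-- Once `k` is large, the residue is the vertex that maximizes the dual functional. -/
theorem eventually_residue_eq_single (hL : 2 ≤ L) {A : Fin L → Fin L → ℝ}
    (hAd : (Matrix.of A).det ≠ 0) (hA : ∀ r, A r ∈ stdSimplex ℝ (Fin L)) {i : Fin L}
    {l : Fin L → ℝ} (hl : IsDual A i l) {m : Fin L} (hm : ∀ m', m' ≠ m → l m' < l m) :
    ∀ᶠ k : ℕ in atTop, ∀ (ν : {j // j ≠ i} → ℝ) (g : Fin L → ℝ), g ∈ stdSimplex ℝ (Fin L) →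
      ∑ j, ν j < 1 → targetCoord k A i = (1 - ∑ j, ν j) • g + ∑ j, ν j • A j →
      (∀ ν' : {j // j ≠ i} → ℝ, (∀ j, 0 ≤ ν' j) → ∑ j, ν' j • A j ≤ targetCoord k A i →
        ∑ j, ν' j ≤ ∑ j, ν j) → g = Pi.single m 1 := by
  have hle : ∀ m', l m' ≤ l m := fun m' => by
    by_cases h : m' = m
    · rw [h]
    · exact (hm m' h).le
  have hdot_le : ∀ g ∈ stdSimplex ℝ (Fin L), g ⬝ᵥ l ≤ l m := fun g hg => by
    calc g ⬝ᵥ l ≤ ∑ n, g n * l m :=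
          Finset.sum_le_sum fun n _ => mul_le_mul_of_nonneg_left (hle n) (hg.1 n)
      _ = l m := by rw [← Finset.sum_mul, hg.2, one_mul]
  have hpos : 0 < l m := by
    have h1 := hl i
    rw [if_pos rfl] at h1
    linarith [hdot_le (A i) (hA i)]
  obtain ⟨c, hc⟩ := exists_row_combination hAd (Pi.single m 1)
  have hci : c i = l m := by
    rw [← hl.sum_smul_dotProduct c, ← hc]; simp
  have hL' : (0 : ℝ) < (L : ℝ) - 1 := by
    have : (2 : ℝ) ≤ L := by exact_mod_cast hL
    linarith
  -- Solving `Pi.single m 1 = ∑ r, c r • A r` for `A i` and substituting in the target gives these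
  -- weights. They tend to `1 / (L - 1) > 0`, so the vertex `m` becomes a feasible residue.
  let ν₀ : ℕ → {j // j ≠ i} → ℝ := fun k j =>
    (1 - 1 / (k : ℝ)) * (1 / ((L : ℝ) - 1)) - 1 / (k : ℝ) * (c j / l m)
  have hν₀ : ∀ᶠ k : ℕ in atTop, ∀ j, 0 ≤ ν₀ k j := by
    refine eventually_all.2 fun j => ?_
    have h0 : Tendsto (fun k : ℕ => 1 / (k : ℝ)) atTop (𝓝 0) := tendsto_one_div_atTop_nhds_zero_nat
    have h1 : Tendsto (fun k => ν₀ k j) atTop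
        (𝓝 ((1 - 0) * (1 / ((L : ℝ) - 1)) - 0 * (c j / l m))) :=
      ((tendsto_const_nhds.sub h0).mul_const _).sub (h0.mul_const _)
    refine (h1.eventually (lt_mem_nhds ?_)).mono fun k hk => hk.le
    simpa using hL'
  filter_upwards [hν₀, eventually_ge_atTop 1] with k hk hk1 ν g hg hs htgt hmax
  have hk0 : (0 : ℝ) < 1 / k := by positivity
  have hdecomp : targetCoord k A i =
      (1 / (k : ℝ) / l m) • Pi.single m 1 + ∑ j, ν₀ k j • A j := by
    rw [hc, Fintype.sum_eq_add_sum_subtype_ne _ i, hci, smul_add, smul_smul,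
      div_mul_cancel₀ _ hpos.ne', add_assoc, targetCoord, Finset.smul_sum, Finset.smul_sum,
      Finset.smul_sum, ← Finset.sum_add_distrib]
    congr 1
    refine Finset.sum_congr rfl fun j _ => ?_
    rw [smul_smul, smul_smul, ← add_smul]
    congr 1
    simp only [ν₀]
    ring
  have hsum : ∑ j, ν₀ k j = 1 - 1 / (k : ℝ) / l m := by
    have h1 := (targetCoord_mem hL hk1 hA i).2
    rw [hdecomp] at h1
    simp only [Pi.add_apply, Finset.sum_add_distrib, Pi.smul_apply, Finset.sum_apply,
      smul_eq_mul] at h1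
    rw [← Finset.mul_sum, Finset.sum_comm] at h1
    simp only [← Finset.mul_sum, (hA _).2, mul_one] at h1
    simp at h1
    simp
    linarith
  have h1 := hmax (ν₀ k) hk (by
    rw [hdecomp]
    refine le_add_of_nonneg_left fun n => ?_
    have : (0 : ℝ) ≤ (Pi.single m 1 : Fin L → ℝ) n := (single_mem_stdSimplex ℝ m).1 n
    exact mul_nonneg (by positivity) this)
  have h2 := hl.residue_dotProduct htgt
  -- The competitor `ν₀` leaves mass `1 / (k * l m)`; a maximizer leaves no more, so its residue has
  -- at least the value `l m`.
  have hge : l m ≤ g ⬝ᵥ l := by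
    have h3 : 1 - ∑ j, ν j ≤ 1 / (k : ℝ) / l m := by linarith
    have h4 : 0 < g ⬝ᵥ l := by
      by_contra hneg
      have := mul_nonpos_of_nonneg_of_nonpos (sub_pos.2 hs).le (not_lt.1 hneg)
      linarith
    have h5 := mul_le_mul_of_nonneg_right h3 h4.le
    rw [h2, div_mul_eq_mul_div, le_div_iff₀ hpos] at h5
    exact le_of_mul_le_mul_left h5 hk0
  have hzero : ∑ n, g n * (l m - l n) = 0 := by
    refine le_antisymm ?_
      (Finset.sum_nonneg fun n _ => mul_nonneg (hg.1 n) (sub_nonneg.2 (hle n)))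
    simp only [mul_sub, Finset.sum_sub_distrib, ← Finset.sum_mul, hg.2, one_mul]
    exact sub_nonpos.2 hge
  rw [Finset.sum_eq_zero_iff_of_nonneg
    fun n _ => mul_nonneg (hg.1 n) (sub_nonneg.2 (hle n))] at hzero
  have hoff : ∀ n, n ≠ m → g n = 0 := fun n hn =>
    (mul_eq_zero.1 (hzero n (Finset.mem_univ n))).resolve_right (sub_pos.2 (hm n hn)).ne'
  have hgm : g m = 1 := by
    rw [← hg.2, Finset.sum_eq_single m (fun n _ hn => hoff n hn) (by simp)]
  funext n
  by_cases hn : n = m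
  · rw [hn, hgm, Pi.single_eq_same]
  · rw [hoff n hn, Pi.single_eq_of_ne hn]

/-- The rows in use before the `i`-th update: those of `x` up to `i`, those of `q` from `i` on. -/
def hybrid (q x : Fin L → Fin L → ℝ) (i : ℕ) : Fin L → Fin L → ℝ :=
  fun r => if r.val < i then x r else q r

theorem hybrid_update (q x : Fin L → Fin L → ℝ) (i : Fin L) (g : Fin L → ℝ) :
    hybrid q (Function.update x i g) (i + 1) = Function.update (hybrid q x i) i g := by
  funext r
  by_cases hr : r = i
  · subst hr; simp [hybrid]
  · have : r.val < i.val + 1 ↔ r.val < i.val := by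
      have := Fin.val_ne_of_ne hr
      omega
    simp [hybrid, Function.update_of_ne hr, this]

theorem hybrid_mem {q x : Fin L → Fin L → ℝ} (hq : ∀ r, q r ∈ stdSimplex ℝ (Fin L))
    (hx : ∀ r, x r ∈ stdSimplex ℝ (Fin L)) (i : ℕ) (r : Fin L) :
    hybrid q x i r ∈ stdSimplex ℝ (Fin L) := by
  unfold hybrid; split_ifs; exacts [hx r, hq r]

/-- The condition on the draws under which the algorithm succeeds. -/
def Generic (q : Fin L → Fin L → ℝ) : Prop :=
  (Matrix.of q).det ≠ 0 ∧ ∀ (σ : Equiv.Perm (Fin L)) (i r₀ : Fin L), i < r₀ →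
    (Matrix.of fun r j => if i < r then q r j else
      if r = i then (Pi.single (σ i) 1 - Pi.single (σ r₀) 1 : Fin L → ℝ) j else
        (Pi.single (σ r) 1 : Fin L → ℝ) j).det ≠ 0

/-- For generic draws, the maximizer of the dual functional is unique and new. -/
theorem Generic.exists_argmax {q : Fin L → Fin L → ℝ} (h : Generic q)
    (hq : ∀ r, q r ∈ stdSimplex ℝ (Fin L)) (σ : Equiv.Perm (Fin L)) (i : Fin L)
    {l : Fin L → ℝ} (hl : IsDual (hybrid q (fun r => Pi.single (σ r) 1) i) i l) :
    ∃ σ' : Equiv.Perm (Fin L), (∀ r < i, σ' r = σ r) ∧ ∀ m', m' ≠ σ' i → l m' < l (σ' i) := by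
  have : Nonempty (Fin L) := ⟨i⟩
  obtain ⟨m, hm⟩ := Finite.exists_max l
  have hlow : ∀ r < i, l (σ r) = 0 := fun r hr => by
    have := hl r
    rw [if_neg hr.ne] at this
    simpa [hybrid, hr] using this
  have hrow : ∀ r, i < r → q r ⬝ᵥ l = 0 := fun r hr => by
    have := hl r
    rw [if_neg hr.ne'] at this
    simpa [hybrid, not_lt.2 hr.le] using this
  have hpos : 0 < l m := by
    have h1 := hl i
    simp only [hybrid, lt_self_iff_false, if_false, if_true] at h1
    have : q i ⬝ᵥ l ≤ l m := by
      calc q i ⬝ᵥ l ≤ ∑ n, q i n * l m :=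
            Finset.sum_le_sum fun n _ => mul_le_mul_of_nonneg_left (hm n) ((hq i).1 n)
        _ = l m := by rw [← Finset.sum_mul, (hq i).2, one_mul]
    linarith
  have hge : ∀ n, l n = l m → i ≤ σ.symm n := fun n hn => by
    by_contra hlt
    have := hlow _ (not_le.1 hlt)
    rw [σ.apply_symm_apply] at this
    linarith
  -- Only the first values of the permutation matter; the swap brings `m` to position `i` without
  -- disturbing the earlier ones.
  have hσ' : ∀ r < i, (σ * Equiv.swap i (σ.symm m)) r = σ r := fun r hr => by
    rw [Equiv.Perm.mul_apply,
      Equiv.swap_apply_of_ne_of_ne hr.ne (hr.trans_le (hge m rfl)).ne]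
  have hi : (σ * Equiv.swap i (σ.symm m)) i = m := by simp
  refine ⟨σ * Equiv.swap i (σ.symm m), hσ', ?_⟩
  rw [hi]
  intro m' hm'
  refine lt_of_le_of_ne (hm m') fun heq => ?_
  set τ := σ * Equiv.swap i (σ.symm m) with hτ
  have hr₀ : i < τ.symm m' := by
    by_contra hlt
    rcases (not_lt.1 hlt).eq_or_lt with h1 | h1
    · rw [← hi, ← h1, τ.apply_symm_apply] at hm'
      exact hm' rfl
    · have h2 := hlow _ h1
      rw [← hσ' _ h1, τ.apply_symm_apply] at h2
      linarith
  -- A tie between `m` and `m'` makes the nonzero `l` vanish on `e_m - e_m'`, on the earlier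
  -- vertices and on the later draws: a singular matrix that `Generic` excludes.
  refine h.2 τ i _ hr₀ (Matrix.exists_mulVec_eq_zero_iff.1 ⟨l, ?_, ?_⟩)
  · rintro rfl
    simp at hpos
  · funext r
    simp only [Matrix.mulVec, Pi.zero_apply]
    rcases lt_trichotomy r i with hr | rfl | hr
    · simp only [Matrix.of_apply, hr.not_gt, hr.ne, if_false]
      rw [hσ' r hr]
      simpa using hlow r hr
    · simp only [Matrix.of_apply, lt_self_iff_false, if_false, if_true]
      refine (sub_dotProduct _ _ _).trans ?_
      rw [hi, τ.apply_symm_apply]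
      simp [heq]
    · simp only [Matrix.of_apply, hr, if_true]
      exact hrow r hr

/-- For generic draws and large `k`, if the candidates found so far in this round are distinct
vertices, then so are those obtained after one more update. -/
theorem Generic.eventually_residue (hL : 2 ≤ L) {q : Fin L → Fin L → ℝ} (h : Generic q)
    (hq : ∀ r, q r ∈ stdSimplex ℝ (Fin L)) :
    ∀ᶠ k : ℕ in atTop, ∀ (σ : Equiv.Perm (Fin L)) (i : Fin L) (A : Fin L → Fin L → ℝ),
      A = hybrid q (fun r => Pi.single (σ r) 1) i → (Matrix.of A).det ≠ 0 →
      ∀ (ν : {j // j ≠ i} → ℝ) (g : Fin L → ℝ), g ∈ stdSimplex ℝ (Fin L) →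
      ∑ j, ν j < 1 → targetCoord k A i = (1 - ∑ j, ν j) • g + ∑ j, ν j • A j →
      (∀ ν' : {j // j ≠ i} → ℝ, (∀ j, 0 ≤ ν' j) → ∑ j, ν' j • A j ≤ targetCoord k A i →
        ∑ j, ν' j ≤ ∑ j, ν j) →
      ∃ σ' : Equiv.Perm (Fin L), (∀ r < i, σ' r = σ r) ∧ g = Pi.single (σ' i) 1 := by
  -- There are finitely many pairs `(σ, i)`, so one threshold for `k` serves them all.
  refine eventually_all.2 fun σ => eventually_all.2 fun i => ?_
  by_cases hd : (Matrix.of (hybrid q (fun r => Pi.single (σ r) 1) i)).det = 0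
  · exact .of_forall fun k A hA hA' => absurd (hA ▸ hd) hA'
  obtain ⟨l, hl⟩ := exists_isDual hd i
  obtain ⟨σ', h1, h2⟩ := h.exists_argmax hq σ i hl
  filter_upwards [eventually_residue_eq_single hL hd
    (hybrid_mem hq (fun r => single_mem_stdSimplex ℝ (σ r)) i) hl h2] with k hk A hA _ ν g
  subst hA
  exact fun hg hs htgt hmax => ⟨σ', h1, hk ν g hg hs htgt hmax⟩

/-- Almost all draws are generic. -/
theorem ae_generic (hL : 1 ≤ L) {M : Matrix (Fin L) (Fin L) ℝ} (hM : M.det ≠ 0) :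
    ∀ᵐ w ∂(drawLaw L), Generic fun r => w r ᵥ* M := by
  refine Filter.Eventually.and ?_ ?_
  · have := ae_det_ne_zero hL hM (A := 1) (by simp) Finset.univ
    simpa using this
  · simp only [eventually_all]
    intro σ i r₀ hi
    -- Before any row is replaced by a draw, the matrix is a permutation matrix with one row
    -- subtracted from another, of determinant `±1`.
    have hdet : ((σ.permMatrix ℝ).updateRow i
        ((σ.permMatrix ℝ) i + (-1 : ℝ) • (σ.permMatrix ℝ) r₀)).det ≠ 0 := by
      rw [Matrix.det_updateRow_add_smul_self _ hi.ne, Matrix.det_permutation]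
      simp
    filter_upwards [ae_det_ne_zero hL hM hdet (Finset.univ.filter fun r => i < r)] with w hw
    convert hw using 4 with r j
    have hrow : ∀ r, (σ.permMatrix ℝ) r = Pi.single (σ r) 1 := fun r => by
      funext j
      rw [Pi.single_apply]
      simp [Equiv.Perm.permMatrix, PEquiv.toMatrix_apply, eq_comm]
    by_cases h1 : i < r
    · simp [h1]
    · by_cases h2 : r = i
      · subst h2
        simp [hrow, sub_eq_add_neg]
      · simp only [h1, h2, hrow, Finset.mem_filter, Finset.mem_univ, true_and, if_false,
          Matrix.updateRow_ne, ne_eq, not_false_eq_true]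

theorem det_ne_zero_of_rank_eq {M : Matrix (Fin L) (Fin L) ℝ} (hM : M.rank = L) : M.det ≠ 0 := by
  rw [← isUnit_iff_ne_zero, ← Matrix.isUnit_iff_isUnit_det,
    ← Matrix.linearIndependent_rows_iff_isUnit, linearIndependent_iff_card_eq_finrank_span,
    Fintype.card_fin, Set.finrank, ← Matrix.rank_eq_finrank_span_row, hM]

end Update

/-! ### Executions of the algorithm -/

section Executions

open Matrix Filter

variable {X : Type*} [MeasurableSpace X] {L : ℕ} {P : Fin L → ProbabilityMeasure X}

/-- Candidates left over from the previous round are not read before being overwritten, so only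
`hybrid` matters. -/
theorem others_combo (q x : Fin L → Fin L → ℝ) (i : Fin L) :
    others (fun r => combo P (q r)) (fun r => combo P (x r)) i =
      fun j : {j // j ≠ i} => combo P (hybrid q x i j) := by
  funext j
  simp only [others, hybrid, Fin.lt_def]
  split_ifs <;> rfl

theorem target_combo (k : ℕ) (q x : Fin L → Fin L → ℝ) (i : Fin L) :
    target k (fun r => combo P (q r)) (fun r => combo P (x r)) i =
      combo P (targetCoord k (hybrid q x i) i) := by
  rw [target, targetCoord, others_combo]
  simp [hybrid]

theorem update_combo (x : Fin L → Fin L → ℝ) (i : Fin L) (g : Fin L → ℝ) :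
    Function.update (fun r => combo P (x r)) i (combo P g) =
      fun r => combo P (Function.update x i g r) := by
  funext r
  by_cases h : r = i
  · subst h; simp
  · simp [h]

theorem update_mem {x : Fin L → Fin L → ℝ} (hx : ∀ r, x r ∈ stdSimplex ℝ (Fin L)) (i : Fin L)
    {g : Fin L → ℝ} (hg : g ∈ stdSimplex ℝ (Fin L)) (r : Fin L) :
    Function.update x i g r ∈ stdSimplex ℝ (Fin L) := by
  by_cases h : r = i
  · subst h; simpa using hg
  · simpa [h] using hx r

/-- Coordinates of a residue chosen by the algorithm. -/
theorem residue_coordinates (hL : 2 ≤ L) (hA : JointlyIrreducible P) {k : ℕ} (hk : 1 ≤ k)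
    {q x : Fin L → Fin L → ℝ} (hq : ∀ r, q r ∈ stdSimplex ℝ (Fin L))
    (hx : ∀ r, x r ∈ stdSimplex ℝ (Fin L)) {i : Fin L} {G : SignedMeasure X}
    (hG : IsResidue (target k (fun r => combo P (q r)) (fun r => combo P (x r)) i)
      (others (fun r => combo P (q r)) (fun r => combo P (x r)) i) G) :
    ∃ (ν : {j // j ≠ i} → ℝ) (g : Fin L → ℝ), g ∈ stdSimplex ℝ (Fin L) ∧ G = combo P g ∧
      ∑ j, ν j < 1 ∧
      targetCoord k (hybrid q x i) i = (1 - ∑ j, ν j) • g + ∑ j, ν j • hybrid q x i j ∧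
      ∀ ν' : {j // j ≠ i} → ℝ, (∀ j, 0 ≤ ν' j) →
        ∑ j, ν' j • hybrid q x i j ≤ targetCoord k (hybrid q x i) i →
        ∑ j, ν' j ≤ ∑ j, ν j := by
  rw [target_combo, others_combo] at hG
  exact hG.exists_coordinates hA (targetCoord_mem hL hk (hybrid_mem hq hx i) i)
    fun j : {j // j ≠ i} => hybrid_mem hq hx i j

/-- The candidates are always mixtures of `P`, and only `P` is ever returned. -/
theorem Reaches.sound (hL : 2 ≤ L) (hA : JointlyIrreducible P) {M : Matrix (Fin L) (Fin L) ℝ}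
    (hM : ∀ i, M i ∈ stdSimplex ℝ (Fin L)) {q : Fin L → Fin L → ℝ}
    (hq : ∀ r, q r ∈ stdSimplex ℝ (Fin L)) {c : Config X L}
    (h : Reaches (partialLabelMatrix M) (contaminated M P) (fun r => combo P (q r)) c) :
    (∀ k i W, c = Config.running k i W →
      1 ≤ k ∧ ∃ x : Fin L → Fin L → ℝ, (∀ r, x r ∈ stdSimplex ℝ (Fin L)) ∧
        W = fun r => combo P (x r)) ∧
    ∀ R, c = Config.returned R → ∀ i, R i = distr (P i) := by
  induction h with
  | refl =>
    refine ⟨fun k i W e => ?_, fun R e => by cases e⟩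
    cases e
    exact ⟨by norm_num, q, hq, rfl⟩
  | tail _ hs ih =>
    cases hs with
    | update k i W G hG =>
      refine ⟨fun k' i' W' e => ?_, fun R e => by cases e⟩
      cases e
      obtain ⟨hk, x, hx, rfl⟩ := ih.1 _ _ _ rfl
      obtain ⟨ν, g, hg, rfl, -⟩ := residue_coordinates hL hA hk hq hx hG
      exact ⟨hk, _, update_mem hx i hg, update_combo x i g⟩
    | again k W C hv =>
      refine ⟨fun k' i' W' e => ?_, fun R e => by cases e⟩
      cases e
      obtain ⟨hk, x, hx, rfl⟩ := ih.1 _ _ _ rfl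
      exact ⟨by omega, x, hx, rfl⟩
    | done k W C hv =>
      refine ⟨fun k' i' W' e => (by cases e), fun R e i => ?_⟩
      cases e
      obtain ⟨hk, x, hx, rfl⟩ := ih.1 _ _ _ rfl
      exact mix_of_vertexTest_eq_true hA hM hx hv i

theorem sound_of_mem_convexHull (hL : 2 ≤ L) (hA : JointlyIrreducible P)
    {M : Matrix (Fin L) (Fin L) ℝ} (hM : ∀ i, M i ∈ stdSimplex ℝ (Fin L))
    {Q : Fin L → SignedMeasure X} (hQ : ∀ i, Q i ∈ convexHull ℝ (Set.range (contaminated M P)))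
    {R : Fin L → SignedMeasure X}
    (h : Reaches (partialLabelMatrix M) (contaminated M P) Q (Config.returned R)) (i : Fin L) :
    R i = distr (P i) := by
  -- Arbitrary draws, possibly dependent, still have coordinates in the simplex, which is all that
  -- soundness needs.
  have hsub : convexHull ℝ (Set.range (contaminated M P)) ⊆ combo P '' stdSimplex ℝ (Fin L) := by
    refine convexHull_min ?_ ((convex_stdSimplex ℝ (Fin L)).linear_image (combo P))
    rintro _ ⟨r, rfl⟩
    rw [contaminated_eq]
    exact ⟨M r, hM r, rfl⟩
  choose q hq e using fun i => hsub (hQ i)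
  obtain rfl : (fun r => combo P (q r)) = Q := funext e
  exact (Reaches.sound hL hA hM hq h).2 R rfl i

/-- For draws in general position, with `K` so large that from round `K` on the residues of
vertices are vertices, the candidates stay in general position and round `K` is the last one. -/
theorem Reaches.invariant (hL : 2 ≤ L) (hA : JointlyIrreducible P) {M : Matrix (Fin L) (Fin L) ℝ}
    (hM : ∀ i, M i ∈ stdSimplex ℝ (Fin L))
    (hC : ∀ j j', (∀ i, partialLabelMatrix M i j = partialLabelMatrix M i j') → j = j')
    {q : Fin L → Fin L → ℝ} (hq : ∀ r, q r ∈ stdSimplex ℝ (Fin L))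
    (hdet : (Matrix.of q).det ≠ 0) {K : ℕ} (hK2 : 2 ≤ K)
    (hK : ∀ (σ : Equiv.Perm (Fin L)) (i : Fin L) (A : Fin L → Fin L → ℝ),
      A = hybrid q (fun r => Pi.single (σ r) 1) i → (Matrix.of A).det ≠ 0 →
      ∀ (ν : {j // j ≠ i} → ℝ) (g : Fin L → ℝ), g ∈ stdSimplex ℝ (Fin L) →
      ∑ j, ν j < 1 → targetCoord K A i = (1 - ∑ j, ν j) • g + ∑ j, ν j • A j →
      (∀ ν' : {j // j ≠ i} → ℝ, (∀ j, 0 ≤ ν' j) → ∑ j, ν' j • A j ≤ targetCoord K A i →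
        ∑ j, ν' j ≤ ∑ j, ν j) →
      ∃ σ' : Equiv.Perm (Fin L), (∀ r < i, σ' r = σ r) ∧ g = Pi.single (σ' i) 1)
    {k i : ℕ} {W : Fin L → SignedMeasure X}
    (h : Reaches (partialLabelMatrix M) (contaminated M P) (fun r => combo P (q r))
      (Config.running k i W)) :
    1 ≤ k ∧ k ≤ K ∧ i ≤ L ∧ ∃ x : Fin L → Fin L → ℝ, (∀ r, x r ∈ stdSimplex ℝ (Fin L)) ∧
      W = (fun r => combo P (x r)) ∧ (Matrix.of (hybrid q x i)).det ≠ 0 ∧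
      (k = K → ∃ σ : Equiv.Perm (Fin L), ∀ r, r.val < i → x r = Pi.single (σ r) 1) := by
  have h0 : ∀ x, hybrid q x 0 = q := fun x => funext fun r => by simp [hybrid]
  generalize hc : Config.running k i W = c at h
  induction h generalizing k i W with
  | refl =>
    cases hc
    exact ⟨by norm_num, hK2, Nat.zero_le _, q, hq, rfl, by rwa [h0], fun _ => ⟨1, by simp⟩⟩
  | tail _ hs ih =>
    cases hs with
    | update k i W G hG =>
      cases hc
      obtain ⟨hk, hkK, -, x, hx, rfl, hd, hσ⟩ := ih rfl
      obtain ⟨ν, g, hg, rfl, hs, htgt, hmax⟩ := residue_coordinates hL hA hk hq hx hG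
      refine ⟨hk, hkK, i.2, _, update_mem hx i hg, update_combo x i g, ?_, fun hkeq => ?_⟩
      · rw [hybrid_update]
        exact det_update_residue_ne_zero hd hk htgt
      · subst hkeq
        obtain ⟨σ, hσ⟩ := hσ rfl
        have hhyb : hybrid q x i = hybrid q (fun r => Pi.single (σ r) 1) i := by
          funext r
          unfold hybrid
          split_ifs with hr
          · exact hσ r hr
          · rfl
        obtain ⟨σ', h1, h2⟩ := hK σ i _ hhyb hd ν g hg hs htgt hmax
        refine ⟨σ', fun r hr => ?_⟩
        by_cases hri : r = i
        · subst hri; simpa using h2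
        · have hlt : r < i := by
            have := Fin.val_ne_of_ne hri
            rw [Fin.lt_def]; omega
          rw [Function.update_of_ne hri, hσ r hlt, h1 r hlt]
    | again k W C hv =>
      cases hc
      obtain ⟨hk, hkK, -, x, hx, rfl, hd, hσ⟩ := ih rfl
      -- At the end of round `K` all candidates are distinct vertices, so the test cannot fail. In a
      -- new round `hybrid` is `q` again, which restores the determinant condition.
      have hlt : k < K := by
        refine lt_of_le_of_ne hkK fun hkeq => ?_
        obtain ⟨σ, hσ⟩ := hσ hkeq
        obtain rfl : x = fun r => Pi.single (σ r) 1 := funext fun r => hσ r r.2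
        have := vertexTest_single hA hM hC σ
        rw [hv] at this
        cases this
      exact ⟨by omega, hlt, Nat.zero_le _, x, hx, rfl, by rwa [h0], fun _ => ⟨1, by simp⟩⟩
    | done k W C hv => cases hc

/-- For generic draws, every execution returns. -/
theorem Generic.terminates (hL : 2 ≤ L) (hA : JointlyIrreducible P)
    {M : Matrix (Fin L) (Fin L) ℝ} (hM : ∀ i, M i ∈ stdSimplex ℝ (Fin L))
    (hC : ∀ j j', (∀ i, partialLabelMatrix M i j = partialLabelMatrix M i j') → j = j')
    {q : Fin L → Fin L → ℝ} (hq : ∀ r, q r ∈ stdSimplex ℝ (Fin L)) (hgen : Generic q) :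
    Terminates (partialLabelMatrix M) (contaminated M P) (fun r => combo P (q r)) := by
  -- A single good round is enough; `2 ≤ K` because the counter starts at `2`.
  obtain ⟨K, hK, hK2⟩ := ((hgen.eventually_residue hL hq).and (eventually_ge_atTop 2)).exists
  have hinv := fun {k i W} => Reaches.invariant (k := k) (i := i) (W := W) hL hA hM hC hq
    hgen.1 hK2 hK
  refine ⟨?_, fun k i W h => ?_⟩
  · rintro ⟨f, hf0, hf⟩
    have hreach : ∀ n, Reaches (partialLabelMatrix M) (contaminated M P)
        (fun r => combo P (q r)) (f n) := by
      intro n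
      induction n with
      | zero => rw [hf0]; exact Relation.ReflTransGen.refl
      | succ n ih => exact Relation.ReflTransGen.tail ih (hf n)
    -- The quantity `k * (L + 1) + i` grows by one at each step that does not return, the passage
    -- from `(k, L)` to `(k + 1, 0)` included, whereas the invariant bounds it by `K * (L + 1) + L`.
    have hrun : ∀ n, ∃ k i W, f n = Config.running k i W ∧ n ≤ k * (L + 1) + i := by
      intro n
      induction n with
      | zero => exact ⟨2, 0, _, hf0, Nat.zero_le _⟩
      | succ n ih =>
        obtain ⟨k, i, W, e, hn⟩ := ih
        have hstep := hf n
        have hnext := hf (n + 1)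
        rw [e] at hstep
        generalize f (n + 1) = c at hstep hnext
        cases hstep with
        | update => exact ⟨_, _, _, rfl, by omega⟩
        | again => exact ⟨_, _, _, rfl, by rw [add_mul]; omega⟩
        | done => cases hnext
    obtain ⟨k, i, W, e, hn⟩ := hrun (K * (L + 1) + L + 1)
    have hr := hreach (K * (L + 1) + L + 1)
    rw [e] at hr
    obtain ⟨-, hk, hi, -⟩ := hinv hr
    have := Nat.mul_le_mul_right (L + 1) hk
    omega
  · obtain ⟨hk, -, hi, x, hx, rfl, hd, -⟩ := hinv h
    rcases hi.lt_or_eq with hi | rfl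
    · obtain ⟨G, hG⟩ := exists_isResidue hA
        (targetCoord_mem hL hk (hybrid_mem hq hx i) ⟨i, hi⟩)
        (fun j : {j // j ≠ (⟨i, hi⟩ : Fin L)} => hybrid_mem hq hx i j)
        (targetCoord_ne_sum hd hk ⟨i, hi⟩)
      refine ⟨_, Step.update k ⟨i, hi⟩ _ G ?_⟩
      rw [target_combo, others_combo]
      exact hG
    · rcases hv : vertexTest (partialLabelMatrix M) (contaminated M P)
        (fun r => combo P (x r)) with ⟨b, C⟩
      cases b
      · exact ⟨_, Step.again k _ C hv⟩
      · exact ⟨_, Step.done k _ C hv⟩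

theorem mix_contaminated (w : Fin L → Fin L → ℝ) (M : Matrix (Fin L) (Fin L) ℝ) :
    mix w (contaminated M P) = fun r => combo P (w r ᵥ* M) := by
  funext r
  rw [contaminated_eq, Matrix.vecMul_eq_sum]
  exact sum_smul_combo P (w r) fun j => M j

theorem vecMul_mem_stdSimplex {M : Matrix (Fin L) (Fin L) ℝ}
    (hM : ∀ i, M i ∈ stdSimplex ℝ (Fin L)) {u : Fin L → ℝ} (hu : u ∈ stdSimplex ℝ (Fin L)) :
    u ᵥ* M ∈ stdSimplex ℝ (Fin L) := by
  rw [Matrix.vecMul_eq_sum]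
  exact (convex_stdSimplex ℝ (Fin L)).sum_mem (fun j _ => hu.1 j) hu.2 fun j _ => hM j

end Executions

end PartialLabel

theorem theorem10 {X : Type*} [MeasurableSpace X] {L : ℕ} (hL : 2 ≤ L)
    (P : Fin L → ProbabilityMeasure X)
    (M : Matrix (Fin L) (Fin L) ℝ) (hM : ∀ i, M i ∈ stdSimplex ℝ (Fin L))
    (hA : JointlyIrreducible P)
    (hB : M.rank = L)
    (hC : ∀ j j', (∀ i, partialLabelMatrix M i j = partialLabelMatrix M i j') → j = j') :
    -- whatever is drawn, whatever is returned is `P`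
    (∀ Q : Fin L → SignedMeasure X,
      (∀ i, Q i ∈ convexHull ℝ (Set.range (contaminated M P))) →
      ∀ R, Reaches (partialLabelMatrix M) (contaminated M P) Q (Config.returned R) →
        ∀ i, R i = distr (P i)) ∧
    -- with probability one, every execution does return, and it returns `P`
    (∀ᵐ w ∂(drawLaw L),
      Terminates (partialLabelMatrix M) (contaminated M P) (mix w (contaminated M P)) ∧
      ∀ R, Reaches (partialLabelMatrix M) (contaminated M P) (mix w (contaminated M P))
        (Config.returned R) → ∀ i, R i = distr (P i)) := by
  have hMdet := det_ne_zero_of_rank_eq hB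
  refine ⟨fun Q hQ R h i => sound_of_mem_convexHull hL hA hM hQ h i, ?_⟩
  have := isProbabilityMeasure_uniformSimplex L (by omega)
  have hmem : ∀ᵐ w ∂(drawLaw L), ∀ r, w r ∈ stdSimplex ℝ (Fin L) :=
    Filter.eventually_all.2 fun r =>
      (Measure.tendsto_eval_ae_ae (i := r)).eventually (ae_uniformSimplex_mem L)
  filter_upwards [hmem, ae_generic (by omega) hMdet] with w hw hgen
  have hq := fun r => vecMul_mem_stdSimplex hM (hw r)
  rw [show mix w (contaminated M P) = _ from mix_contaminated w M]
  exact ⟨hgen.terminates hL hA hM hC hq, fun R h => (Reaches.sound hL hA hM hq h).2 R rfl⟩
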